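/- Let $n\ge 3$. Let $\widetilde\Delta$ be a finite disjoint union of oriented Euclidean $n$-simplices, and let $\Phi$ be a family of orientation-reversing affine isomorphisms (face pairings), closed under inverses, that pairs the $(n-1)$-dimensional faces (facets) of $\widetilde\Delta$, each facet $\tau$ being paired with a facet different from $\tau$ by a unique $\varphi_\tau\in\Phi$ with domain $\tau$. Let $\widehat M=\widetilde\Delta/\Phi$ be the quotient pseudo-manifold, $p:\widetilde\Delta\to\widehat M$ the quotient map, and assume that $\widehat M$ is connected. The image under $p$ of a $k$-simplex is called a $k$-singlex; the $0$-singlexes are the vertices of the triangulation, and $M$ is the complement of the set of vertices in $\widehat M$. The triangulation is called even if every $(n-2)$-singlex $\tau$ has even degree, i.e. the number of $(n-2)$-simplices of $\widetilde\Delta$ mapped onto $\tau$ is even. Crossing a facet $\tau$ of an $n$-simplex $\sigma$ into the $n$-simplex $\sigma'$ containing $\varphi_\tau(\tau)$ defines a bijection from the vertices of $\sigma$ to those of $\sigma'$ (a perspectivity), equal to $\varphi_\tau$ on the vertices of $\tau$ and sending the vertex opposite $\tau$ to the vertex opposite $\varphi_\tau(\tau)$. For a path $\gamma$ in the dual graph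 (the graph in $M$ with one vertex at the barycentre of each $n$-simplex and one edge crossing each pair of identified facets), the projectivity $p_\gamma$ is the composite of the perspectivities of the facets that $\gamma$ crosses in succession. Fix an $n$-simplex $\sigma_0$, and let $x_0\in M$ be the image of its barycentre. (1) If the vertices $v$ and $v'$ of $\sigma_0$ have the same image in $\widehat M$, then there is a loop $\gamma$ in the dual graph based at $x_0$, which may be chosen constant or without backtracking (it never leaves an $n$-simplex through the facet by which it has just entered), so a class $[\gamma]\in\pi_1(M,x_0)$, with $p_\gamma(v)=v'$. (2) Suppose that the triangulation is even and has fewer than $n+1$ vertices. If $n\ge4$, suppose moreover that $p$ is injective on the relative interior of each face of each $n$-simplex, and that for $1\le k\le n-3$ the link of each $k$-singlex is simply connected (as is the case if the triangulation restricts to a combinatorial manifold structure on $M$). Then there is a unique homomorphism $\rho:\pi_1(M,x_0)\to\mathrm{Sym}(\sigma_0)$, the canonical symmetric representation, with $\rho([\gamma])=p_\gamma$ for every loop $\gamma$ in the dual graph based at $x_0$; the image of $\rho$ is non-trivial, and hence $\pi_1(M,x_0)$ is non-trivial. Here the link of a singlex $\tau$ is the boundary of a small normal slice to $\tau$ at its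 barycentre: it is made of one copy of the face opposite to $F$ in the $n$-simplex containing $F$, for each simplex $F$ of $\widetilde\Delta$ mapped onto $\tau$, glued as in $\widehat M$. -/

import Mathlib

noncomputable section

/-- An oriented singular triangulation of a closed `n`-dimensional pseudo-manifold: a family, indexed
by `ι`, of oriented `n`-simplices, each with vertex set `Fin (n + 1)`, together with
orientation-reversing affine isomorphisms pairing their facets.

The facet of the simplex `s` opposite to its vertex `i` is denoted `(s, i)`. It is paired with the
facet `(adj s i, glue s i i)` by the affine isomorphism sending the vertex `j ≠ i` of `s` to the
vertex `glue s i j` of `adj s i`. The permutation `glue s i` moreover sends the vertex `i`, opposite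
to the first facet, to the vertex opposite to the second one, so that it is the vertex map of the
*perspectivity* `s → adj s i` defined by the facet `(s, i)`. -/
structure SingularTriangulation (n : ℕ) (ι : Type*) where
  /-- the orientation of each simplex, relative to the order of its vertices -/
  orientation : ι → ℤˣ
  /-- the simplex on the other side of the facet `(s, i)` -/
  adj : ι → Fin (n + 1) → ι
  /-- the vertex map of the face pairing with domain `(s, i)`, extended to the opposite vertices -/
  glue : ι → Fin (n + 1) → Equiv.Perm (Fin (n + 1))
  /-- the face pairings come in inverse pairs -/
  adj_adj : ∀ s i, adj (adj s i) (glue s i i) = s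
  glue_glue : ∀ s i, glue (adj s i) (glue s i i) = (glue s i)⁻¹
  /-- no facet is paired with itself -/
  pair_ne : ∀ s i, (adj s i, glue s i i) ≠ (s, i)
  /-- The face pairing reverses the induced orientations of the facets; equivalently its extension
  to opposite vertices reverses the orientations of the `n`-simplices. -/
  orientation_adj : ∀ s i,
    orientation (adj s i) * Equiv.Perm.sign (glue s i) = -orientation s

namespace SingularTriangulation

variable {n : ℕ} {ι : Type*} (T : SingularTriangulation n ι)

/-- The disjoint union of the `n`-simplices. -/
abbrev Simplices (_ : SingularTriangulation n ι) : Type _ :=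
  (_ : ι) × stdSimplex ℝ (Fin (n + 1))

/-- `T.Rel a b`: the point `a` lies on a facet, and the face pairing of that facet maps `a` to `b`. -/
def Rel (a b : T.Simplices) : Prop :=
  ∃ i, a.2 i = 0 ∧ b.1 = T.adj a.1 i ∧ ∀ j, b.2 (T.glue a.1 i j) = a.2 j

/-- The closed pseudo-manifold `M̂`: the quotient of the disjoint union of the simplices by the face
pairings, with the quotient topology. -/
def Space : Type _ := Quot T.Rel

instance : TopologicalSpace T.Space := inferInstanceAs (TopologicalSpace (Quot T.Rel))

/-- The quotient map. -/
def proj (a : T.Simplices) : T.Space := Quot.mk T.Rel a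

lemma continuous_proj : Continuous T.proj := continuous_quot_mk

/-- The closed face of the simplex `s` spanned by the set `F` of its vertices. -/
def face (s : ι) (F : Finset (Fin (n + 1))) : Set T.Simplices :=
  {a | a.1 = s ∧ ∀ i ∉ F, a.2 i = 0}

/-- The singlex which is the image of the face of `s` spanned by `F`. -/
def singlex (s : ι) (F : Finset (Fin (n + 1))) : Set T.Space := T.proj '' T.face s F

/-- The image of the `k`-skeleton. -/
def skeleton (k : ℕ) : Set T.Space :=
  ⋃ (s : ι) (F : Finset (Fin (n + 1))) (_ : F.card = k + 1), T.singlex s F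

/-- The degree of the singlex which is the image of the face of `s` spanned by `F`: the number of
faces of the `n`-simplices that are mapped onto it. -/
def degree (s : ι) (F : Finset (Fin (n + 1))) : ℕ :=
  Set.ncard {f : ι × Finset (Fin (n + 1)) | T.singlex f.1 f.2 = T.singlex s F}

/-- The triangulation is even if every `(n-2)`-singlex has even degree. -/
def IsEven : Prop :=
  ∀ (s : ι) (F : Finset (Fin (n + 1))), F.card + 1 = n → Even (T.degree s F)

/-- The quotient map is injective on the relative interior of each face of each simplex (the relative
interior of a face consists of the points whose nonzero barycentric coordinates are precisely
those belonging to the vertices of the face). -/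
def InjectiveOnInteriors : Prop :=
  ∀ (s : ι) (x y : stdSimplex ℝ (Fin (n + 1))), (∀ i, x i = 0 ↔ y i = 0) →
    T.proj ⟨s, x⟩ = T.proj ⟨s, y⟩ → x = y

/-- The link of a singlex `τ` (the image of the face of `s` spanned by `F`), as the boundary of a
normal slice at the barycentre of `τ`. In each `n`-simplex with a face `F'` mapped onto `τ` one takes
the points whose barycentric coordinates at the vertices of `F'` are all equal, with total weight
`n / (n + 1)`. They form a copy of the face opposite to `F'`. Since the remaining total weight
`1 / (n + 1)` is less than each coordinate on `F'` whenever `F` has fewer than `n` vertices,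
slices for different faces of the same simplex are then disjoint. -/
def link (s : ι) (F : Finset (Fin (n + 1))) : Set T.Space :=
  T.proj '' {a | ∃ F' : Finset (Fin (n + 1)), T.singlex a.1 F' = T.singlex s F ∧
    ∀ i ∈ F', a.2 i = (n / (n + 1) : ℝ) / F'.card}

/-- For `1 ≤ k ≤ n - 3`, the link of every `k`-singlex is simply connected. -/
def LinksSimplyConnected : Prop :=
  ∀ (s : ι) (F : Finset (Fin (n + 1))), 2 ≤ F.card → F.card + 2 ≤ n →
    SimplyConnectedSpace (T.link s F)

/-! ### Facet paths and projectivities -/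

/-- Paths in the dual graph from the simplex `s` to the simplex `t`, recorded as the sequence of
facets which are crossed: `cons s i γ` first crosses the facet `(s, i)` and then follows `γ`. -/
inductive FacetPath : ι → ι → Type _
  | nil (s : ι) : FacetPath s s
  | cons {t : ι} (s : ι) (i : Fin (n + 1)) (γ : FacetPath (T.adj s i) t) : FacetPath s t

namespace FacetPath

variable {T}

/-- The projectivity of a facet path: the composite of the perspectivities of the facets crossed, as
a map from the vertices of the first simplex to the vertices of the last one. -/
def projectivity : {s t : ι} → T.FacetPath s t → Equiv.Perm (Fin (n + 1))
  | _, _, nil _ => 1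
  | _, _, cons s i γ => γ.projectivity * T.glue s i

/-- The first facet crossed by the facet path is the one opposite to `i`. -/
def StartsAt : {s t : ι} → T.FacetPath s t → Fin (n + 1) → Prop
  | _, _, nil _, _ => False
  | _, _, cons _ j _, i => j = i

/-- No backtracking: each simplex on the way is entered and left through distinct facets. -/
def IsReduced : {s t : ι} → T.FacetPath s t → Prop
  | _, _, nil _ => True
  | _, _, cons s i γ => ¬ γ.StartsAt (T.glue s i i) ∧ γ.IsReduced

end FacetPath

/-! ### The complement of the vertices and the dual graph in it -/

/-- The complement `M` of the set of vertices in the pseudo-manifold `M̂`. -/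
abbrev Punctured : Type _ := ((T.skeleton 0)ᶜ : Set T.Space)

lemma exists_eq_one_of_mem_skeleton_zero {a : T.Simplices} (h : T.proj a ∈ T.skeleton 0) :
    ∃ j, a.2 j = 1 := by
  have key : ∀ a b : T.Simplices, T.Rel a b → (∃ j, a.2 j = 1) = (∃ j, b.2 j = 1) := by
    rintro a b ⟨i, -, -, hb⟩
    refine propext ⟨?_, ?_⟩
    · rintro ⟨j, hj⟩
      exact ⟨T.glue a.1 i j, (hb j).trans hj⟩
    · rintro ⟨j, hj⟩
      refine ⟨(T.glue a.1 i).symm j, ?_⟩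
      rw [← hb, Equiv.apply_symm_apply, hj]
  simp only [skeleton, Set.mem_iUnion] at h
  obtain ⟨s, F, hF, b, ⟨-, hb⟩, hab⟩ := h
  have h1 : ∃ j, b.2 j = 1 := by
    obtain ⟨j, rfl⟩ := Finset.card_eq_one.mp hF
    refine ⟨j, ?_⟩
    rw [← stdSimplex.sum_eq_one b.2]
    refine (Finset.sum_eq_single j (fun k _ hk => hb k ?_) (by simp)).symm
    simpa using hk
  have h2 : Quot.lift _ key (T.proj b) := h1
  rw [hab] at h2
  exact h2

/-- The barycentre of the facet opposite to the vertex `i`. -/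
def facetBarycenter (hn : 3 ≤ n) (i : Fin (n + 1)) : stdSimplex ℝ (Fin (n + 1)) :=
  ⟨fun j => if j = i then 0 else (n : ℝ)⁻¹, by
    refine ⟨fun j => ?_, ?_⟩
    · dsimp only
      split_ifs <;> positivity
    · have : (n : ℝ) ≠ 0 := by positivity
      simp [Finset.sum_ite, Finset.filter_ne', this]⟩

/-- The point at time `t` on the straight segment from the barycentre of the standard simplex to the
barycentre of its facet opposite to `i`. -/
def spoke (hn : 3 ≤ n) (i : Fin (n + 1)) (t : unitInterval) : stdSimplex ℝ (Fin (n + 1)) :=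
  ⟨AffineMap.lineMap (stdSimplex.barycenter : stdSimplex ℝ (Fin (n + 1))).1
      (facetBarycenter hn i).1 (t : ℝ),
    (convex_stdSimplex ℝ (Fin (n + 1))).lineMap_mem (stdSimplex.barycenter).2
      (facetBarycenter hn i).2 t.2⟩

lemma spoke_zero (hn : 3 ≤ n) (i : Fin (n + 1)) : spoke hn i 0 = stdSimplex.barycenter := by
  apply Subtype.ext
  simp [spoke]

lemma spoke_one (hn : 3 ≤ n) (i : Fin (n + 1)) : spoke hn i 1 = facetBarycenter hn i := by
  apply Subtype.ext
  simp [spoke]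

lemma continuous_spoke (hn : 3 ≤ n) (i : Fin (n + 1)) : Continuous (spoke hn i) := by
  refine Continuous.subtype_mk ?_ _
  exact AffineMap.lineMap_continuous.comp continuous_subtype_val

lemma proj_spoke_notMem (hn : 3 ≤ n) (s : ι) (i : Fin (n + 1)) (t : unitInterval) :
    T.proj ⟨s, spoke hn i t⟩ ∈ (T.skeleton 0)ᶜ := by
  intro h
  obtain ⟨j, hj⟩ := T.exists_eq_one_of_mem_skeleton_zero h
  have hn' : (3 : ℝ) ≤ n := by exact_mod_cast hn
  have e : spoke hn i t j
      = (1 - (t : ℝ)) * ((n : ℝ) + 1)⁻¹ + t * (if j = i then 0 else (n : ℝ)⁻¹) := by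
    change (AffineMap.lineMap (stdSimplex.barycenter : stdSimplex ℝ (Fin (n + 1))).1
      (facetBarycenter hn i).1 (t : ℝ)) j = _
    simp [AffineMap.lineMap_apply_module, facetBarycenter]
  have h1 : ((n : ℝ) + 1)⁻¹ ≤ 1 / 3 := by
    rw [inv_le_comm₀ (by positivity) (by norm_num)]; norm_num; linarith
  have h2 : (if j = i then 0 else (n : ℝ)⁻¹) ≤ 1 / 3 := by
    split_ifs
    · norm_num
    · rw [inv_le_comm₀ (by positivity) (by norm_num)]; norm_num; linarith
  have ht0 := t.2.1
  have ht1 := t.2.2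
  have hj' : spoke hn i t j = 1 := hj
  rw [e] at hj'
  nlinarith [mul_le_mul_of_nonneg_left h1 (sub_nonneg.mpr ht1), mul_le_mul_of_nonneg_left h2 ht0]

/-- The image in `M` of the barycentre of the simplex `s`. -/
def center (hn : 3 ≤ n) (s : ι) : T.Punctured :=
  ⟨T.proj ⟨s, stdSimplex.barycenter⟩, spoke_zero hn 0 ▸ T.proj_spoke_notMem hn s 0 0⟩

/-- The image in `M` of the barycentre of the facet `(s, i)`. -/
def facetCenter (hn : 3 ≤ n) (s : ι) (i : Fin (n + 1)) : T.Punctured :=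
  ⟨T.proj ⟨s, facetBarycenter hn i⟩, spoke_one hn i ▸ T.proj_spoke_notMem hn s i 1⟩

lemma facetCenter_adj (hn : 3 ≤ n) (s : ι) (i : Fin (n + 1)) :
    T.facetCenter hn (T.adj s i) (T.glue s i i) = T.facetCenter hn s i := by
  refine Subtype.ext (Quot.sound ⟨i, ?_, rfl, fun j => ?_⟩).symm
  · change (if i = i then (0 : ℝ) else (n : ℝ)⁻¹) = 0
    simp
  · change (if T.glue s i j = T.glue s i i then (0 : ℝ) else (n : ℝ)⁻¹)
      = if j = i then 0 else (n : ℝ)⁻¹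
    simp

/-- The half-edge of the dual graph from the barycentre of `s` straight to the barycentre of its
facet `(s, i)`. -/
def halfEdge (hn : 3 ≤ n) (s : ι) (i : Fin (n + 1)) :
    Path (T.center hn s) (T.facetCenter hn s i) where
  toFun t := ⟨T.proj ⟨s, spoke hn i t⟩, T.proj_spoke_notMem hn s i t⟩
  continuous_toFun := Continuous.subtype_mk
    (T.continuous_proj.comp (continuous_sigmaMk.comp (continuous_spoke hn i))) _
  source' := Subtype.ext (by simp [center, spoke_zero])
  target' := Subtype.ext (by simp [facetCenter, spoke_one])

/-- The edge of the dual graph which crosses the facet `(s, i)`. -/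
def dualEdge (hn : 3 ≤ n) (s : ι) (i : Fin (n + 1)) :
    Path (T.center hn s) (T.center hn (T.adj s i)) :=
  (T.halfEdge hn s i).trans
    ((T.halfEdge hn (T.adj s i) (T.glue s i i)).symm.cast (T.facetCenter_adj hn s i).symm rfl)

/-- The path in `M`, contained in the dual graph, which crosses the facets of a facet path. -/
def FacetPath.dualPath {T : SingularTriangulation n ι} (hn : 3 ≤ n) :
    {s t : ι} → T.FacetPath s t → Path (T.center hn s) (T.center hn t)
  | _, _, nil s => Path.refl (T.center hn s)
  | _, _, cons s i γ => (T.dualEdge hn s i).trans (γ.dualPath hn)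

/-- The class in `π₁(M, x₀)` of a facet loop based at `s`, where `x₀` is the barycentre of `s`. -/
def FacetPath.loopClass {T : SingularTriangulation n ι} (hn : 3 ≤ n) {s : ι}
    (γ : T.FacetPath s s) : FundamentalGroup T.Punctured (T.center hn s) :=
  FundamentalGroup.fromPath ⟦γ.dualPath hn⟧

/-- `ρ` is the canonical symmetric representation based at `s`: it is the homomorphism
`π₁(M, x₀) → Sym(s)` with `[γ] ↦ p_γ` for every loop `γ` in the dual graph. (The product in Mathlib's
fundamental group is `[α] * [β] = [β · α]`, path `β` first, matching the composition of maps.) -/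
def IsCanonicalRepresentation (hn : 3 ≤ n) (s : ι)
    (ρ : FundamentalGroup T.Punctured (T.center hn s) →* Equiv.Perm (Fin (n + 1))) : Prop :=
  ∀ γ : T.FacetPath s s, ρ (γ.loopClass hn) = γ.projectivity

end SingularTriangulation

end

/-!
The vertices of the simplices, with those of adjacent simplices identified by the perspectivities,
form a space over `M̂`, the vertex cover: over the point `x` of a simplex it has one point for
each orbit of the vertices of that simplex under the holonomy at `x`, which consists of the
projectivities of the facet loops that stay near `x`. Over the points with trivial holonomy it is
a covering with `n + 1` sheets, and its monodromy along a dual path is the projectivity of that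
path. Thus `ρ` exists as soon as the holonomy is trivial at all points of `M`.

Let `x` lie in the interior of a face `F`. If `F` has at least `n` vertices the holonomy at `x` is
trivial. If `F` has `n - 1` vertices, the simplices around `F` form a cycle, and going once around
it fixes `F` and the two remaining vertices when the degree is even. For smaller `F` with at least
two vertices, the link of the singlex of `F` consists of points in the interiors of larger faces,
over which the vertex cover is a covering by induction; since the link is simply connected, this
covering has no monodromy, and so the holonomy at `x` is trivial.

The open stars of the points of `M` are contractible, so every loop in `M` is a product of loops
that run along dual paths, and `ρ` is unique. If there are fewer than `n + 1` vertices, two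
vertices of a simplex have the same image, and the projectivity taking one to the other is a
non-trivial element of the image of `ρ`.
-/

noncomputable section
namespace SingularTriangulation
open stdSimplex Topology Pointwise
variable {n : ℕ} {ι : Type*} {T : SingularTriangulation n ι}

@[simp]
lemma apply_mem_smul_finset_iff {X : Type*} [DecidableEq X] {g : Equiv.Perm X} {F : Finset X}
    {j : X} : g j ∈ g • F ↔ j ∈ F :=
  Finset.smul_mem_smul_finset_iff (a := g)

section Simplex

variable {X : Type*} [Fintype X] {g : Equiv.Perm X} {a b : stdSimplex ℝ X}

@[simp]
lemma map_perm_apply (g : Equiv.Perm X) (a : stdSimplex ℝ X) (j : X) : map g a (g j) = a j := by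
  classical
  simp [FunOnFinite.linearMap_apply_apply, Finset.sum_filter]

lemma map_perm_eq_iff : map g a = b ↔ ∀ j, b (g j) = a j := by
  refine ⟨by rintro rfl j; simp, fun h => ?_⟩
  ext j
  obtain ⟨j, rfl⟩ := g.surjective j
  exact (map_perm_apply g a j).trans (h j).symm

@[simp]
lemma map_perm_one (a : stdSimplex ℝ X) : map (1 : Equiv.Perm X) a = a :=
  map_id_apply a

lemma map_perm_mul (g h : Equiv.Perm X) (a : stdSimplex ℝ X) :
    map (g * h : Equiv.Perm X) a = map g (map h a) :=
  (map_comp_apply h g a).symm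

lemma continuous_coord (j : X) : Continuous fun a : stdSimplex ℝ X => a j :=
  (continuous_apply j).comp continuous_subtype_val

/-- The point at time `r` on the straight segment from `a` to `b`. -/
def mix (a b : stdSimplex ℝ X) (r : unitInterval) : stdSimplex ℝ X :=
  ⟨AffineMap.lineMap a.1 b.1 (r : ℝ), (convex_stdSimplex ℝ X).lineMap_mem a.2 b.2 r.2⟩

lemma mix_apply (a b : stdSimplex ℝ X) (r : unitInterval) (j : X) :
    mix a b r j = (1 - (r : ℝ)) * a j + r * b j := by
  change AffineMap.lineMap a.1 b.1 (r : ℝ) j = _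
  simp only [AffineMap.lineMap_apply_module, Pi.add_apply, Pi.smul_apply, smul_eq_mul]
  rfl

@[simp]
lemma mix_zero (a b : stdSimplex ℝ X) : mix a b 0 = a :=
  Subtype.ext (by simp [mix])

@[simp]
lemma mix_one (a b : stdSimplex ℝ X) : mix a b 1 = b :=
  Subtype.ext (by simp [mix])

lemma map_perm_mix (g : Equiv.Perm X) (a b : stdSimplex ℝ X) (r : unitInterval) :
    map g (mix a b r) = mix (map g a) (map g b) r := by
  simp [map_perm_eq_iff, mix_apply]

lemma continuous_mix :
    Continuous fun p : (stdSimplex ℝ X × stdSimplex ℝ X) × unitInterval => mix p.1.1 p.1.2 p.2 := by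
  refine Continuous.subtype_mk ?_ _
  simp only [AffineMap.lineMap_apply_module]
  fun_prop

open Classical in
/-- The set of vertices spanning the face whose relative interior contains `a`. -/
def carrier (a : stdSimplex ℝ X) : Finset X := {j | a j ≠ 0}

@[simp]
lemma mem_carrier {j : X} : j ∈ carrier a ↔ a j ≠ 0 := by
  simp [carrier]

lemma carrier_nonempty (a : stdSimplex ℝ X) : (carrier a).Nonempty := by
  by_contra! h
  have h0 : ∀ j, a j = 0 := fun j => by simpa using Finset.eq_empty_iff_forall_notMem.mp h j
  simpa [h0] using sum_eq_one a

lemma eq_vertex_of_apply_eq_one [DecidableEq X] {j : X} (h : a j = 1) : a = vertex j := by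
  have hsum := sum_eq_one a
  rw [← Finset.add_sum_erase _ _ (Finset.mem_univ j), h, add_eq_left,
    Finset.sum_eq_zero_iff_of_nonneg fun k _ => zero_le a k] at hsum
  ext i
  change a i = (Pi.single j 1 : X → ℝ) i
  rcases eq_or_ne i j with rfl | hij
  · rw [h, Pi.single_eq_same]
  · rw [Pi.single_eq_of_ne hij, hsum i (Finset.mem_erase.mpr ⟨hij, Finset.mem_univ _⟩)]

lemma exists_carrier_eq_injOn {F : Finset X} (hF : F.Nonempty) :
    ∃ a : stdSimplex ℝ X, carrier a = F ∧ Set.InjOn a F := by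
  classical
  obtain ⟨w, hw, hinj⟩ : ∃ w : X → ℝ, (∀ i, 0 < w i) ∧ w.Injective :=
    ⟨fun i => (Fintype.equivFin X i : ℝ) + 1, fun i => by positivity, fun i j h => by
      simpa [Fin.val_inj] using h⟩
  have hS : 0 < ∑ i ∈ F, w i := Finset.sum_pos (fun i _ => hw i) hF
  obtain ⟨a, ha⟩ : ∃ a : stdSimplex ℝ X, ∀ j, a j = if j ∈ F then w j / ∑ i ∈ F, w i else 0 := by
    refine ⟨⟨fun j => if j ∈ F then w j / ∑ i ∈ F, w i else 0, fun j => ?_, ?_⟩, fun _ => rfl⟩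
    · have := (hw j).le
      dsimp only; split_ifs <;> positivity
    · rw [Finset.sum_ite_mem, Finset.univ_inter, ← Finset.sum_div, div_self hS.ne']
  refine ⟨a, ?_, fun i hi j hj h => hinj ?_⟩
  · ext j
    simp [ha, (hw j).ne', hS.ne']
  · rwa [ha, ha, if_pos (Finset.mem_coe.mp hi), if_pos (Finset.mem_coe.mp hj),
      div_left_inj' hS.ne'] at h

lemma carrier_map_perm [DecidableEq X] (g : Equiv.Perm X) (a : stdSimplex ℝ X) :
    carrier (map g a) = g • carrier a := by
  ext j
  obtain ⟨j, rfl⟩ := g.surjective j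
  simp

end Simplex

variable {F F' : Finset (Fin (n + 1))} {s t u : ι} {g h : Equiv.Perm (Fin (n + 1))}
  {a b : stdSimplex ℝ (Fin (n + 1))}

/-! ### Holonomy around a face -/

variable (T) in
/-- `T.Holonomy F s t g`: there is a facet path from `s` to `t` with projectivity `g` all of whose
simplices contain the face `F` of `s`, transported along the path; that is, it never crosses a facet
opposite to a vertex which corresponds to an element of `F`. -/
inductive Holonomy (F : Finset (Fin (n + 1))) (s : ι) : ι → Equiv.Perm (Fin (n + 1)) → Prop
  | refl : Holonomy F s s 1
  | step {t : ι} {g : Equiv.Perm (Fin (n + 1))} (h : Holonomy F s t g) {l : Fin (n + 1)}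
      (hl : l ∉ F) : Holonomy F s (T.adj t (g l)) (T.glue t (g l) * g)

namespace Holonomy

lemma mono (hF : F' ⊆ F) (H : T.Holonomy F s t g) : T.Holonomy F' s t g := by
  induction H with
  | refl => exact refl
  | step _ hl ih => exact ih.step fun h => hl (hF h)

lemma trans (H : T.Holonomy F s t g) (K : T.Holonomy (g • F) t u h) :
    T.Holonomy F s u (h * g) := by
  induction K with
  | refl => simpa using H
  | @step _ _ _ l hl ih =>
    obtain ⟨l, rfl⟩ := g.surjective l
    simpa [mul_assoc] using ih.step (by simpa using hl)

lemma single {i : Fin (n + 1)} (hi : i ∉ F) : T.Holonomy F s (T.adj s i) (T.glue s i) := by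
  simpa using (refl (T := T) (F := F) (s := s)).step hi

lemma symm (H : T.Holonomy F s t g) : T.Holonomy (g • F) t s g⁻¹ := by
  induction H with
  | refl => simpa using refl
  | @step t g _ l hl ih =>
    have back : T.Holonomy (T.glue t (g l) • g • F) (T.adj t (g l)) t (T.glue t (g l))⁻¹ := by
      have := single (T := T) (s := T.adj t (g l)) (F := T.glue t (g l) • g • F)
        (i := T.glue t (g l) (g l)) (by simpa using hl)
      rwa [T.adj_adj, T.glue_glue] at this
    rw [mul_inv_rev, mul_smul]
    exact back.trans (by rwa [inv_smul_smul])

lemma proj_map (H : T.Holonomy F s t g) (ha : carrier a ⊆ F) :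
    T.proj ⟨t, map g a⟩ = T.proj ⟨s, a⟩ := by
  induction H with
  | refl => simp
  | @step t g _ l hl ih =>
    refine ih ▸ (Quot.sound ⟨g l, ?_, rfl, fun j => ?_⟩).symm
    · simpa using mt (@ha l) hl
    · dsimp only
      rw [map_perm_mul, map_perm_apply]

end Holonomy

instance : Std.Symm T.Rel := by
  refine ⟨?_⟩
  rintro ⟨s, a⟩ ⟨t, b⟩ ⟨i, hi, rfl, hb⟩
  dsimp only at hi hb
  refine ⟨T.glue s i i, by simpa [hb] using hi, (T.adj_adj s i).symm, fun j => ?_⟩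
  dsimp only
  rw [T.glue_glue, ← hb]
  simp

lemma quot_mk_eq_iff_reflTransGen {α : Type*} {r : α → α → Prop} [Std.Symm r] {x y : α} :
    Quot.mk r x = Quot.mk r y ↔ Relation.ReflTransGen r x y := by
  rw [Quot.eq, Relation.EqvGen.eqvGen_eq_reflTransGen]

lemma proj_eq_iff :
    T.proj ⟨s, a⟩ = T.proj ⟨t, b⟩ ↔ ∃ g, T.Holonomy (carrier a) s t g ∧ map g a = b := by
  refine ⟨fun h => ?_, ?_⟩
  · have key : ∀ x : T.Simplices, Relation.ReflTransGen T.Rel ⟨s, a⟩ x →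
        ∃ g, T.Holonomy (carrier a) s x.1 g ∧ map g a = x.2 := by
      intro x hx
      induction hx with
      | refl => exact ⟨1, .refl, by simp⟩
      | @tail y z _ hyz ih =>
        obtain ⟨y, y'⟩ := y
        obtain ⟨z, z'⟩ := z
        obtain ⟨g, hg, rfl⟩ := ih
        obtain ⟨i, hi, rfl, hz⟩ := hyz
        obtain ⟨l, rfl⟩ := g.surjective i
        exact ⟨_, hg.step (by simpa using hi),
          by simpa only [map_perm_mul, map_perm_eq_iff] using hz⟩
    exact key _ (quot_mk_eq_iff_reflTransGen.mp h)
  · rintro ⟨g, hg, rfl⟩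
    exact (hg.proj_map subset_rfl).symm

lemma exists_proj_eq (x : T.Space) : ∃ s a, T.proj ⟨s, a⟩ = x := by
  obtain ⟨⟨s, a⟩, rfl⟩ := Quot.exists_rep x
  exact ⟨s, a, rfl⟩

namespace FacetPath

lemma projectivity_cast (h : s = u) (γ : T.FacetPath s t) :
    (h ▸ γ : T.FacetPath u t).projectivity = γ.projectivity := by
  subst h; rfl

lemma isReduced_cast (h : s = u) (γ : T.FacetPath s t) :
    (h ▸ γ : T.FacetPath u t).IsReduced ↔ γ.IsReduced := by
  subst h; rfl

lemma StartsAt.exists_tail {γ : T.FacetPath s t} {i : Fin (n + 1)} (hi : γ.StartsAt i)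
    (hγ : γ.IsReduced) : ∃ δ : T.FacetPath (T.adj s i) t,
      δ.IsReduced ∧ γ.projectivity = δ.projectivity * T.glue s i := by
  cases γ with
  | nil => exact hi.elim
  | cons _ j δ =>
    obtain rfl : j = i := hi
    exact ⟨δ, hγ.2, rfl⟩

lemma exists_isReduced (γ : T.FacetPath s t) :
    ∃ δ : T.FacetPath s t, δ.IsReduced ∧ δ.projectivity = γ.projectivity := by
  induction γ with
  | nil s => exact ⟨nil s, trivial, rfl⟩
  | cons s i γ ih =>
    obtain ⟨δ, hδ, e⟩ := ih
    by_cases backtracks : δ.StartsAt (T.glue s i i)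
    · obtain ⟨δ', hδ', e'⟩ := backtracks.exists_tail hδ
      refine ⟨T.adj_adj s i ▸ δ', (isReduced_cast _ _).mpr hδ', ?_⟩
      rw [projectivity_cast, projectivity, ← e, e', T.glue_glue, inv_mul_cancel_right]
    · exact ⟨cons s i δ, ⟨backtracks, hδ⟩, by rw [projectivity, projectivity, e]⟩

/-- Concatenation of facet paths. -/
def append : {s t u : ι} → T.FacetPath s t → T.FacetPath t u → T.FacetPath s u
  | _, _, _, nil _, δ => δ
  | _, _, _, cons s i γ, δ => cons s i (γ.append δ)

lemma projectivity_append (γ : T.FacetPath s t) (δ : T.FacetPath t u) :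
    (γ.append δ).projectivity = δ.projectivity * γ.projectivity := by
  induction γ with
  | nil s => simp [append, projectivity]
  | cons s i γ ih => simp [append, projectivity, ih, mul_assoc]

end FacetPath

lemma Holonomy.exists_facetPath (H : T.Holonomy F s t g) :
    ∃ γ : T.FacetPath s t, γ.projectivity = g := by
  induction H with
  | refl => exact ⟨.nil s, rfl⟩
  | step _ _ ih =>
    obtain ⟨γ, rfl⟩ := ih
    exact ⟨γ.append (.cons _ _ (.nil _)), by
      simp [FacetPath.projectivity_append, FacetPath.projectivity]⟩

lemma exists_isReduced_projectivity_eq {v v' : Fin (n + 1)}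
    (h : T.proj ⟨s, vertex v⟩ = T.proj ⟨s, vertex v'⟩) :
    ∃ γ : T.FacetPath s s, γ.IsReduced ∧ γ.projectivity v = v' := by
  obtain ⟨g, hg, e⟩ := proj_eq_iff.mp h
  obtain ⟨γ, rfl⟩ := hg.exists_facetPath
  obtain ⟨δ, hδ, e'⟩ := γ.exists_isReduced
  refine ⟨δ, hδ, ?_⟩
  rw [e']
  have h1 : (vertex v' : stdSimplex ℝ (Fin (n + 1))) (γ.projectivity v) = 1 :=
    (map_perm_eq_iff.mp e v).trans (Pi.single_eq_same v 1)
  by_contra hne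
  exact zero_ne_one ((Pi.single_eq_of_ne hne 1).symm.trans h1)

/-! ### Singlexes -/

lemma mem_face_iff : (⟨t, a⟩ : T.Simplices) ∈ T.face s F ↔ t = s ∧ carrier a ⊆ F := by
  simp only [face, Set.mem_ofPred_eq, Finset.subset_iff, mem_carrier, not_imp_comm, ne_eq]

lemma Holonomy.singlex_subset (H : T.Holonomy F s t g) :
    T.singlex s F ⊆ T.singlex t (g • F) := by
  rintro _ ⟨⟨r, a⟩, ha, rfl⟩
  obtain ⟨rfl, haF⟩ := mem_face_iff.mp ha
  refine ⟨⟨t, map g a⟩, mem_face_iff.mpr ⟨rfl, ?_⟩, H.proj_map haF⟩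
  rw [carrier_map_perm]
  exact Finset.smul_finset_subset_smul_finset haF

lemma Holonomy.singlex_eq (H : T.Holonomy F s t g) : T.singlex t (g • F) = T.singlex s F :=
  subset_antisymm (by simpa using H.symm.singlex_subset) H.singlex_subset

lemma exists_holonomy_of_singlex_subset (hF : F.Nonempty) (h : T.singlex s F ⊆ T.singlex t F') :
    ∃ g, T.Holonomy F s t g ∧ g • F ⊆ F' := by
  obtain ⟨a, rfl, -⟩ := exists_carrier_eq_injOn hF
  obtain ⟨⟨r, b⟩, hb, e⟩ := h ⟨⟨s, a⟩, mem_face_iff.mpr ⟨rfl, subset_rfl⟩, rfl⟩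
  obtain ⟨rfl, hb⟩ := mem_face_iff.mp hb
  obtain ⟨g, hg, rfl⟩ := proj_eq_iff.mp e.symm
  exact ⟨g, hg, by rwa [← carrier_map_perm]⟩

lemma singlex_nonempty_iff : (T.singlex s F).Nonempty ↔ F.Nonempty := by
  refine ⟨?_, fun hF => ?_⟩
  · rintro ⟨_, ⟨t, a⟩, ha, rfl⟩
    exact (carrier_nonempty a).mono (mem_face_iff.mp ha).2
  · obtain ⟨a, rfl, -⟩ := exists_carrier_eq_injOn hF
    exact ⟨_, ⟨s, a⟩, mem_face_iff.mpr ⟨rfl, subset_rfl⟩, rfl⟩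

lemma singlex_eq_iff (hF : F.Nonempty) :
    T.singlex t F' = T.singlex s F ↔ ∃ g, T.Holonomy F s t g ∧ g • F = F' := by
  refine ⟨fun h => ?_, ?_⟩
  · have hF' : F'.Nonempty := by rwa [← singlex_nonempty_iff (T := T) (s := t), h,
      singlex_nonempty_iff]
    obtain ⟨g, hg, hsub⟩ := exists_holonomy_of_singlex_subset hF h.symm.subset
    obtain ⟨g', -, hsub'⟩ := exists_holonomy_of_singlex_subset hF' h.subset
    refine ⟨g, hg, Finset.eq_of_subset_of_card_le hsub ?_⟩
    simpa using Finset.card_le_card hsub'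
  · rintro ⟨g, hg, rfl⟩
    exact hg.singlex_eq

variable (T) in
/-- The projectivities of the facet paths near the point `a` of the simplex `s` which lead back to
`a` are trivial; equivalently, the vertices of the simplices are not permuted when one moves around
the image of `a`. -/
def LocallyTrivial (s : ι) (a : stdSimplex ℝ (Fin (n + 1))) : Prop :=
  ∀ g, T.Holonomy (carrier a) s s g → map g a = a → g = 1

lemma Holonomy.eq_one_of_univ (H : T.Holonomy Finset.univ s t g) : g = 1 := by
  induction H with
  | refl => rfl
  | step _ hl => exact absurd (Finset.mem_univ _) hl

lemma Holonomy.eq_of_compl_singleton {i : Fin (n + 1)} (H : T.Holonomy {i}ᶜ s t g) :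
    (t = s ∧ g = 1) ∨ (t = T.adj s i ∧ g = T.glue s i) := by
  induction H with
  | refl => exact .inl ⟨rfl, rfl⟩
  | @step t g _ l hl ih =>
    obtain rfl : l = i := by simpa using hl
    rcases ih with ⟨rfl, rfl⟩ | ⟨rfl, rfl⟩
    · simp
    · left; simp [T.adj_adj, T.glue_glue]

lemma locallyTrivial_of_carrier_eq_univ (ha : carrier a = Finset.univ) : T.LocallyTrivial s a := by
  intro g hg _
  rw [ha] at hg
  exact hg.eq_one_of_univ

lemma locallyTrivial_of_carrier_eq_compl_singleton {i : Fin (n + 1)} (ha : carrier a = {i}ᶜ) :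
    T.LocallyTrivial s a := by
  intro g hg e
  have hg' := ha ▸ hg
  rcases hg'.eq_of_compl_singleton with ⟨-, h⟩ | ⟨hs, rfl⟩
  · exact h
  · have hcar := ha ▸ e ▸ carrier_map_perm (T.glue s i) a
    have hi : T.glue s i i ∉ T.glue s i • ({i}ᶜ : Finset (Fin (n + 1))) := by simp
    rw [← hcar, Finset.mem_compl, Finset.mem_singleton, not_not] at hi
    exact absurd (Prod.ext hs.symm hi) (T.pair_ne s i)

/-! ### The walk around a face of codimension two -/

section CodimTwo

variable {i j : Fin (n + 1)} {x y : ι × Fin (n + 1) × Fin (n + 1)}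

variable (T) in
/-- The walk around a face of codimension two. The triple `(s, u, v)` stands for the face of `s`
opposite to `u` and `v`, the facet to be crossed next being the one opposite to `u`; after crossing
it, the next one is opposite to the image of `v`. -/
def walk : Equiv.Perm (ι × Fin (n + 1) × Fin (n + 1)) where
  toFun x := (T.adj x.1 x.2.1, T.glue x.1 x.2.1 x.2.2, T.glue x.1 x.2.1 x.2.1)
  invFun x := (T.adj x.1 x.2.2, T.glue x.1 x.2.2 x.2.2, T.glue x.1 x.2.2 x.2.1)
  left_inv x := by simp [T.adj_adj, T.glue_glue]
  right_inv x := by simp [T.adj_adj, T.glue_glue]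

/-- Reversal of the direction of the walk: the two marked vertices are exchanged. -/
def flip : Equiv.Perm (ι × Fin (n + 1) × Fin (n + 1)) :=
  (Equiv.refl ι).prodCongr (Equiv.prodComm _ _)

/-- The face opposite to the two marked vertices. -/
def markedFace (x : ι × Fin (n + 1) × Fin (n + 1)) : ι × Finset (Fin (n + 1)) :=
  (x.1, {x.2.1, x.2.2}ᶜ)

lemma walk_zpow_add_one_apply (k : ℤ) (x : ι × Fin (n + 1) × Fin (n + 1)) :
    (T.walk ^ (k + 1)) x = T.walk ((T.walk ^ k) x) := by
  rw [add_comm k, zpow_one_add, Equiv.Perm.mul_apply]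

lemma walk_zpow_sub_one_apply (k : ℤ) (x : ι × Fin (n + 1) × Fin (n + 1)) :
    (T.walk ^ (k - 1)) x = T.walk⁻¹ ((T.walk ^ k) x) := by
  rw [sub_eq_neg_add, zpow_add, zpow_neg_one, Equiv.Perm.mul_apply]

lemma flip_walk_zpow (k : ℤ) (x : ι × Fin (n + 1) × Fin (n + 1)) :
    flip ((T.walk ^ k) x) = (T.walk ^ (-k)) (flip x) := by
  have h : SemiconjBy flip T.walk T.walk⁻¹ := rfl
  simpa only [inv_zpow', Equiv.Perm.mul_apply] using congr($(h.zpow_right k) x)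

lemma walk_ne_flip (x : ι × Fin (n + 1) × Fin (n + 1)) : T.walk x ≠ flip x :=
  fun h => T.pair_ne x.1 x.2.1 (Prod.ext congr(($h).1) congr(($h).2.2))

lemma walk_zpow_ne (hx : x.2.1 ≠ x.2.2) (k : ℤ) :
    ((T.walk ^ k) x).2.1 ≠ ((T.walk ^ k) x).2.2 := by
  induction k with
  | zero => exact hx
  | succ k ih =>
    rw [walk_zpow_add_one_apply]
    exact fun h => ih ((T.glue _ _).injective h).symm
  | pred k ih =>
    rw [walk_zpow_sub_one_apply]
    exact fun h => ih ((T.glue _ _).injective h).symm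

/-- If the walk came back in the opposite direction, then halfway it would either stay at a face
while exchanging the marked vertices, or cross a facet paired with itself. -/
lemma walk_zpow_ne_flip (hx : x.2.1 ≠ x.2.2) (k : ℤ) : (T.walk ^ k) x ≠ flip x := by
  intro h
  rcases Int.even_or_odd' k with ⟨m, rfl | rfl⟩
  · have halfway : flip ((T.walk ^ m) x) = (T.walk ^ m) x := by
      rw [flip_walk_zpow, ← h, ← Equiv.Perm.mul_apply, ← zpow_add]
      congr 2; ring
    exact walk_zpow_ne hx m congr(($halfway).2.2)
  · have halfway : T.walk ((T.walk ^ m) x) = flip ((T.walk ^ m) x) := by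
      rw [flip_walk_zpow, ← h, ← walk_zpow_add_one_apply, ← Equiv.Perm.mul_apply, ← zpow_add]
      congr 2; ring
    exact walk_ne_flip _ halfway

/-- The walk follows the facet path, one step per facet, forwards or backwards; so the parity of
the number of steps decides both which vertex is marked first and the sign of the projectivity. -/
lemma Holonomy.exists_walk (H : T.Holonomy {i, j}ᶜ s t g) : ∃ k : ℤ,
    (Even k ∧ (T.walk ^ k) (s, i, j) = (t, g i, g j) ∧
      T.orientation t * Equiv.Perm.sign g = T.orientation s) ∨
    (Odd k ∧ (T.walk ^ k) (s, i, j) = (t, g j, g i) ∧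
      T.orientation t * Equiv.Perm.sign g = -T.orientation s) := by
  induction H with
  | refl => exact ⟨0, .inl ⟨Even.zero, rfl, by simp⟩⟩
  | @step t g _ l hl ih =>
    obtain ⟨k, ih⟩ := ih
    have sign_step : T.orientation (T.adj t (g l)) * Equiv.Perm.sign (T.glue t (g l) * g)
        = -(T.orientation t * Equiv.Perm.sign g) := by
      rw [Equiv.Perm.sign_mul, ← mul_assoc, T.orientation_adj, neg_mul]
    have forward := walk_zpow_add_one_apply (T := T) k (s, i, j)
    have backward := walk_zpow_sub_one_apply (T := T) k (s, i, j)
    have hl' : l = i ∨ l = j := by simpa [← not_or] using hl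
    rcases ih with ⟨hk, h, h'⟩ | ⟨hk, h, h'⟩ <;> rw [h] at forward backward <;>
      rw [h'] at sign_step <;> rcases hl' with rfl | rfl
    · exact ⟨k + 1, .inr ⟨hk.add_one, forward, sign_step⟩⟩
    · exact ⟨k - 1, .inr ⟨hk.sub_odd odd_one, backward, sign_step⟩⟩
    · exact ⟨k - 1, .inl ⟨hk.sub_odd odd_one, backward, by rw [sign_step, neg_neg]⟩⟩
    · exact ⟨k + 1, .inl ⟨hk.add_one, forward, by rw [sign_step, neg_neg]⟩⟩

lemma exists_holonomy_walk_zpow (s : ι) (i j : Fin (n + 1)) (k : ℤ) :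
    ∃ t g, T.Holonomy {i, j}ᶜ s t g ∧
      ((T.walk ^ k) (s, i, j) = (t, g i, g j) ∨ (T.walk ^ k) (s, i, j) = (t, g j, g i)) := by
  induction k with
  | zero => exact ⟨s, 1, .refl, .inl rfl⟩
  | succ k ih =>
    obtain ⟨t, g, hg, h | h⟩ := ih <;> simp only [walk_zpow_add_one_apply, h]
    · exact ⟨_, _, hg.step (l := i) (by simp), .inr rfl⟩
    · exact ⟨_, _, hg.step (l := j) (by simp), .inl rfl⟩
  | pred k ih =>
    obtain ⟨t, g, hg, h | h⟩ := ih <;> simp only [walk_zpow_sub_one_apply, h]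
    · exact ⟨_, _, hg.step (l := j) (by simp), .inr rfl⟩
    · exact ⟨_, _, hg.step (l := i) (by simp), .inl rfl⟩

lemma smul_compl_pair (g : Equiv.Perm (Fin (n + 1))) (i j : Fin (n + 1)) :
    g • ({i, j}ᶜ : Finset (Fin (n + 1))) = {g i, g j}ᶜ := by
  ext x
  obtain ⟨x, rfl⟩ := g.surjective x
  simp

lemma card_compl_pair (hij : i ≠ j) : ({i, j}ᶜ : Finset (Fin (n + 1))).card + 1 = n := by
  have := Finset.card_le_univ {i, j}
  rw [Finset.card_pair hij, Fintype.card_fin] at this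
  rw [Finset.card_compl, Fintype.card_fin, Finset.card_pair hij]
  omega

lemma setOf_singlex_eq_image_orbit (hF : ({i, j}ᶜ : Finset (Fin (n + 1))).Nonempty) :
    {f : ι × Finset (Fin (n + 1)) | T.singlex f.1 f.2 = T.singlex s {i, j}ᶜ} =
      markedFace '' MulAction.orbit (Subgroup.zpowers T.walk) (s, i, j) := by
  ext ⟨t, F⟩
  simp only [Set.mem_ofPred_eq, singlex_eq_iff hF, smul_compl_pair]
  constructor
  · rintro ⟨g, hg, rfl⟩
    obtain ⟨k, ⟨-, h, -⟩ | ⟨-, h, -⟩⟩ := hg.exists_walk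
    · exact ⟨_, ⟨⟨T.walk ^ k, k, rfl⟩, h⟩, rfl⟩
    · exact ⟨_, ⟨⟨T.walk ^ k, k, rfl⟩, h⟩, by simp [markedFace, Finset.pair_comm]⟩
  · rintro ⟨_, ⟨⟨_, k, rfl⟩, rfl⟩, hx⟩
    change markedFace ((T.walk ^ k) (s, i, j)) = _ at hx
    obtain ⟨t', g, hg, h | h⟩ := exists_holonomy_walk_zpow (T := T) s i j k <;>
      obtain ⟨rfl, rfl⟩ := Prod.mk.inj (h ▸ hx)
    · exact ⟨g, hg, rfl⟩
    · exact ⟨g, hg, by rw [Finset.pair_comm]⟩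

lemma markedFace_eq_iff : markedFace x = markedFace y ↔ x = y ∨ x = flip y := by
  obtain ⟨s, u, v⟩ := x
  obtain ⟨t, u', v'⟩ := y
  simp only [markedFace, flip, Equiv.prodCongr_apply, Equiv.coe_refl, Equiv.prodComm_apply,
    Prod.map_apply, id, Prod.swap, Prod.mk.injEq, compl_inj_iff, ← and_or_left,
    ← Finset.coe_inj, Finset.coe_pair, Set.pair_eq_pair_iff]

lemma injOn_markedFace_orbit (hij : i ≠ j) :
    Set.InjOn (markedFace (n := n)) (MulAction.orbit (Subgroup.zpowers T.walk) (s, i, j)) := by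
  rintro _ ⟨⟨_, k, rfl⟩, rfl⟩ _ ⟨⟨_, l, rfl⟩, rfl⟩ h
  refine (markedFace_eq_iff.mp h).resolve_right fun h' => ?_
  have := walk_zpow_ne_flip (T := T) (walk_zpow_ne (T := T) (x := (s, i, j)) hij l) (k - l)
  rw [← Equiv.Perm.mul_apply, ← zpow_add, sub_add_cancel] at this
  exact this h'

/-- This also holds when the walk never closes up: both sides are then zero. -/
lemma degree_eq_minimalPeriod (hn : 2 ≤ n) (s : ι) (hij : i ≠ j) :
    T.degree s {i, j}ᶜ = Function.minimalPeriod T.walk (s, i, j) := by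
  have hF : ({i, j}ᶜ : Finset (Fin (n + 1))).Nonempty := by
    have := card_compl_pair hij
    rw [← Finset.card_pos]; omega
  rw [degree, setOf_singlex_eq_image_orbit hF, (injOn_markedFace_orbit hij).ncard_image,
    ← Nat.card_coe_set_eq, Nat.card_congr (MulAction.orbitZPowersEquiv T.walk (s, i, j)),
    Nat.card_zmod]
  rfl

lemma IsEven.even_of_walk_zpow_eq (hn : 2 ≤ n) (hT : T.IsEven) (hij : i ≠ j) {k : ℤ}
    (hk : (T.walk ^ k) (s, i, j) = (s, i, j)) : Even k := by
  have hdeg := hT s {i, j}ᶜ (card_compl_pair hij)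
  rw [degree_eq_minimalPeriod hn s hij, ← Int.even_coe_nat, even_iff_two_dvd] at hdeg
  exact even_iff_two_dvd.mpr (hdeg.trans
    ((MulAction.zpow_smul_eq_iff_minimalPeriod_dvd (a := T.walk) (b := (s, i, j))).mp hk))

lemma Holonomy.fixes_compl_of_isEven (hn : 2 ≤ n) (hT : T.IsEven) (hij : i ≠ j)
    (H : T.Holonomy {i, j}ᶜ s s g) (hg : g • ({i, j}ᶜ : Finset (Fin (n + 1))) = {i, j}ᶜ) :
    g i = i ∧ g j = j ∧ Equiv.Perm.sign g = 1 := by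
  have hpair : g i = i ∧ g j = j ∨ g i = j ∧ g j = i := by
    rwa [smul_compl_pair, compl_inj_iff, ← Finset.coe_inj, Finset.coe_pair, Finset.coe_pair,
      Set.pair_eq_pair_iff] at hg
  have not_reversed (k : ℤ) : (T.walk ^ k) (s, i, j) ≠ (s, j, i) :=
    walk_zpow_ne_flip (x := (s, i, j)) hij k
  obtain ⟨k, ⟨-, h, ho⟩ | ⟨hk, h, ho⟩⟩ := H.exists_walk <;>
    rcases hpair with ⟨hi, hj⟩ | ⟨hi, hj⟩ <;> rw [hi, hj] at h
  · exact ⟨hi, hj, by simpa using ho⟩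
  · exact absurd h (not_reversed k)
  · exact absurd h (not_reversed k)
  · exact absurd (hT.even_of_walk_zpow_eq hn hij h) (Int.not_even_iff_odd.mpr hk)

end CodimTwo

lemma Holonomy.fixes_carrier_of_injectiveOnInteriors (hT : T.InjectiveOnInteriors)
    (H : T.Holonomy (carrier a) s s g) (hg : map g a = a) {j : Fin (n + 1)} (hj : j ∈ carrier a) :
    g j = j := by
  obtain ⟨b, hb, hinj⟩ := exists_carrier_eq_injOn (carrier_nonempty a)
  have hgb : carrier (map g b) = carrier b := by rw [carrier_map_perm, hb, ← carrier_map_perm, hg]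
  have hmap : map g b = b := hT s _ _ (fun i => by
    simpa using not_congr (Finset.ext_iff.mp hgb i)) (H.proj_map hb.le)
  have hgj : g j ∈ carrier a := by
    rw [← hg, carrier_map_perm]
    simpa using hj
  exact hinj hgj hj (map_perm_eq_iff.mp hmap j)

lemma locallyTrivial_of_codim_two (hn : 2 ≤ n) (hT : T.IsEven)
    (hinj : 4 ≤ n → T.InjectiveOnInteriors) {i j : Fin (n + 1)} (hij : i ≠ j)
    (ha : carrier a = {i, j}ᶜ) : T.LocallyTrivial s a := by
  intro g H hg
  obtain ⟨hi, hj, hs⟩ := (ha ▸ H).fixes_compl_of_isEven hn hT hij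
    (by rw [← ha, ← carrier_map_perm, hg])
  rcases lt_or_ge 3 n with h4 | h3
  · ext l
    by_cases hl : l ∈ carrier a
    · exact congrArg _ (H.fixes_carrier_of_injectiveOnInteriors (hinj h4) hg hl)
    · rw [ha, Finset.mem_compl, not_not, Finset.mem_insert, Finset.mem_singleton] at hl
      rcases hl with rfl | rfl
      · rw [hi]; rfl
      · rw [hj]; rfl
  -- For `n ≤ 3` there are at most two further vertices, which an even permutation cannot exchange.
  · by_contra hne
    have hsub : g.support ⊆ {i, j}ᶜ := by
      intro l hl
      rw [Equiv.Perm.mem_support] at hl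
      simp only [Finset.mem_compl, Finset.mem_insert, Finset.mem_singleton, not_or]
      exact ⟨fun e => hl (e ▸ hi), fun e => hl (e ▸ hj)⟩
    have hle := Finset.card_le_card hsub
    have hcard := card_compl_pair hij
    have h2 := Equiv.Perm.two_le_card_support_of_ne_one hne
    have hswap := Equiv.Perm.card_support_eq_two.mp (by omega : g.support.card = 2)
    exact absurd (hswap.sign_eq ▸ hs) (by decide)

/-! ### Star neighbourhoods -/

/-- `T.Near s a ε b g`: the point `b` is within `ε` of the point to which the point `a` of the
simplex `s` is moved by a facet path near `a` with projectivity `g`. -/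
structure Near (s : ι) (a : stdSimplex ℝ (Fin (n + 1))) (ε : ℝ) (b : T.Simplices)
    (g : Equiv.Perm (Fin (n + 1))) : Prop where
  holonomy : T.Holonomy (carrier a) s b.1 g
  abs_lt : ∀ j, |b.2 (g j) - a j| < ε

/-- Distinct elements of `0`, `1` and the coordinates of `a` are at least `2 * ε` apart. -/
structure Separates (a : stdSimplex ℝ (Fin (n + 1))) (ε : ℝ) : Prop where
  pos : 0 < ε
  le_abs_sub : ∀ u ∈ ({0, 1} ∪ Set.range a : Set ℝ), ∀ v ∈ ({0, 1} ∪ Set.range a : Set ℝ),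
    u ≠ v → 2 * ε ≤ |u - v|

lemma exists_separates (a : stdSimplex ℝ (Fin (n + 1))) : ∃ ε, Separates a ε := by
  have hfin : ({0, 1} ∪ Set.range a : Set ℝ).Finite :=
    (Set.toFinite {0, 1}).union (Set.finite_range _)
  have hsep : ∀ᶠ ε : ℝ in 𝓝[>] 0, ∀ u ∈ ({0, 1} ∪ Set.range a : Set ℝ),
      ∀ v ∈ ({0, 1} ∪ Set.range a : Set ℝ), u ≠ v → 2 * ε ≤ |u - v| := by
    simp_rw [Filter.eventually_all_finite hfin]
    intro u _ v _
    by_cases huv : u = v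
    · simp [huv]
    · have hpos : 0 < |u - v| / 2 := half_pos (abs_pos.mpr (sub_ne_zero.mpr huv))
      filter_upwards [Ioo_mem_nhdsGT hpos] with ε hε _
      linarith [hε.2]
  obtain ⟨ε, hpos, h⟩ := (eventually_mem_nhdsWithin.and hsep).exists
  exact ⟨ε, hpos, h⟩

lemma Separates.eq {ε : ℝ} (hε : Separates a ε) {u v x : ℝ}
    (hu : u ∈ ({0, 1} ∪ Set.range a : Set ℝ)) (hv : v ∈ ({0, 1} ∪ Set.range a : Set ℝ))
    (h : |x - u| < ε) (h' : |x - v| < ε) : u = v := by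
  by_contra hne
  have hle := hε.le_abs_sub u hu v hv hne
  have htri := abs_sub_le u x v
  rw [abs_sub_comm u x] at htri
  linarith

lemma near_self (s : ι) {ε : ℝ} (hε : 0 < ε) : T.Near s a ε ⟨s, a⟩ 1 :=
  ⟨.refl, by simpa using hε⟩

namespace Near

variable {ε : ℝ} {x : T.Simplices} {g' : Equiv.Perm (Fin (n + 1))}

lemma carrier_subset (hε : Separates a ε) (H : T.Near s a ε x g) : g • carrier a ⊆ carrier x.2 := by
  intro j hj
  obtain ⟨j, rfl⟩ := g.surjective j
  rw [apply_mem_smul_finset_iff, mem_carrier] at hj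
  rw [mem_carrier]
  contrapose! hj
  exact hε.eq (x := 0) (by simp) (by simp) (by simpa [hj] using H.abs_lt j) (by simpa using hε.pos)

lemma lt_one (hε : Separates a ε) (ha : ∀ j, a j < 1) (H : T.Near s a ε x g) (j : Fin (n + 1)) :
    x.2 j < 1 := by
  refine lt_of_le_of_ne (le_one _ _) fun hj => ?_
  obtain ⟨j, rfl⟩ := g.surjective j
  exact (ha j).ne (hε.eq (x := 1) (by simp) (by simp) (by simpa [hj] using H.abs_lt j)
    (by simpa using hε.pos))

lemma move (hε : Separates a ε) (H : T.Near s a ε x g)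
    (K : T.Holonomy (carrier x.2) x.1 t h) : T.Near s a ε ⟨t, map h x.2⟩ (h * g) := by
  refine ⟨H.holonomy.trans (K.mono (H.carrier_subset hε)), fun j => ?_⟩
  simpa only [Equiv.Perm.mul_apply, map_perm_apply] using H.abs_lt j

lemma map_eq_map (hε : Separates a ε) (H : T.Near s a ε x g) (H' : T.Near s a ε x g') :
    map g a = map g' a := by
  refine map_perm_eq_iff.mpr fun j => ?_
  obtain ⟨k, hk⟩ := g'.surjective (g j)
  rw [← hk, map_perm_apply]
  exact hε.eq (by simp) (by simp) (hk ▸ H'.abs_lt k) (H.abs_lt j)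

lemma eq (hε : Separates a ε) (ha : T.LocallyTrivial s a) (H : T.Near s a ε x g)
    (H' : T.Near s a ε x g') : g = g' := by
  have e := H.map_eq_map hε H'
  have back : T.Holonomy (g' • carrier a) x.1 s g⁻¹ := by
    rw [← carrier_map_perm, ← e, carrier_map_perm]
    exact H.holonomy.symm
  refine inv_mul_eq_one.mp (ha _ (H'.holonomy.trans back) ?_)
  rw [map_perm_mul, ← e, ← map_perm_mul, inv_mul_cancel, map_perm_one]

end Near

lemma isOpen_near (s : ι) (a : stdSimplex ℝ (Fin (n + 1))) (ε : ℝ)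
    (g : Equiv.Perm (Fin (n + 1))) : IsOpen {x : T.Simplices | T.Near s a ε x g} := by
  refine isOpen_sigma_iff.mpr fun t => ?_
  have h : Sigma.mk t ⁻¹' {x : T.Simplices | T.Near s a ε x g} =
      {b | T.Holonomy (carrier a) s t g ∧ ∀ j, |b (g j) - a j| < ε} := by
    ext b
    exact ⟨fun H => ⟨H.holonomy, H.abs_lt⟩, fun H => ⟨H.1, H.2⟩⟩
  simp only [h, Set.ofPred_and, Set.ofPred_forall]
  exact isOpen_const.inter <| isOpen_iInter_of_finite fun j =>
    isOpen_lt ((continuous_coord (g j)).sub continuous_const).abs continuous_const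

variable (T) in
/-- The star neighbourhood of radius `ε` of the image of the point `a` of the simplex `s`. -/
def star (s : ι) (a : stdSimplex ℝ (Fin (n + 1))) (ε : ℝ) : Set T.Space :=
  T.proj '' {x | ∃ g, T.Near s a ε x g}

lemma proj_mem_star_iff {ε : ℝ} (hε : Separates a ε) {x : T.Simplices} :
    T.proj x ∈ T.star s a ε ↔ ∃ g, T.Near s a ε x g := by
  constructor
  · rintro ⟨y, ⟨g, hg⟩, e⟩
    obtain ⟨h, hh, e'⟩ := proj_eq_iff.mp e
    have := hg.move hε hh
    rw [e'] at this
    exact ⟨_, this⟩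
  · exact fun h => ⟨x, h, rfl⟩

lemma isOpen_star {ε : ℝ} (hε : Separates a ε) : IsOpen (T.star s a ε) := by
  have h : T.proj ⁻¹' T.star s a ε = ⋃ g, {x : T.Simplices | T.Near s a ε x g} := by
    ext x
    rw [Set.mem_preimage, proj_mem_star_iff hε, Set.mem_iUnion]
    rfl
  change IsOpen (T.proj ⁻¹' T.star s a ε)
  exact h ▸ isOpen_iUnion fun g => isOpen_near s a ε g

lemma proj_mem_star_self {ε : ℝ} (hε : 0 < ε) : T.proj ⟨s, a⟩ ∈ T.star s a ε :=
  ⟨_, ⟨1, near_self s hε⟩, rfl⟩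

/-! ### The covering by the vertices of the simplices -/

variable (T) in
/-- The face pairings, lifted to points together with a vertex of the simplex containing them. -/
def CoverRel (x y : T.Simplices × Fin (n + 1)) : Prop :=
  ∃ i, x.1.2 i = 0 ∧ y.1.1 = T.adj x.1.1 i ∧ (∀ j, y.1.2 (T.glue x.1.1 i j) = x.1.2 j) ∧
    y.2 = T.glue x.1.1 i x.2

instance : Std.Symm T.CoverRel := by
  refine ⟨?_⟩
  rintro ⟨⟨s, a⟩, v⟩ ⟨⟨t, b⟩, w⟩ ⟨i, hi, rfl, hb, rfl⟩
  dsimp only at hi hb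
  refine ⟨T.glue s i i, by simpa [hb] using hi, (T.adj_adj s i).symm, fun j => ?_, ?_⟩ <;>
    dsimp only
  · rw [T.glue_glue, ← hb]
    simp
  · rw [T.glue_glue]
    simp

variable (T) in
/-- The space of the points of the simplices together with a vertex of the simplex, glued by means
of the perspectivities. It is a covering over the points where the triangulation is locally
trivial. -/
def VertexCover : Type _ := Quot T.CoverRel

instance : TopologicalSpace T.VertexCover := inferInstanceAs (TopologicalSpace (Quot T.CoverRel))

variable (T) in
/-- The quotient map onto the vertex cover. -/
def coverMk (x : T.Simplices) (v : Fin (n + 1)) : T.VertexCover := Quot.mk T.CoverRel (x, v)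

variable (T) in
/-- The covering projection. -/
def coverProj : T.VertexCover → T.Space :=
  Quot.lift (fun x => T.proj x.1) <| by
    rintro x y ⟨i, hi, hadj, hy, -⟩
    exact Quot.sound ⟨i, hi, hadj, hy⟩

@[simp]
lemma coverProj_coverMk (x : T.Simplices) (v : Fin (n + 1)) :
    T.coverProj (T.coverMk x v) = T.proj x := rfl

lemma continuous_coverMk (v : Fin (n + 1)) : Continuous fun x => T.coverMk x v :=
  continuous_quot_mk.comp (by fun_prop : Continuous fun x : T.Simplices => (x, v))

lemma exists_coverMk_eq (e : T.VertexCover) : ∃ x v, T.coverMk x v = e := by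
  obtain ⟨⟨x, v⟩, rfl⟩ := Quot.exists_rep e
  exact ⟨x, v, rfl⟩

lemma isOpen_vertexCover_iff {A : Set T.VertexCover} :
    IsOpen A ↔ ∀ v, IsOpen {x | T.coverMk x v ∈ A} := by
  refine ⟨fun hA v => hA.preimage (continuous_coverMk v), fun hA => ?_⟩
  have h : Quot.mk T.CoverRel ⁻¹' A = ⋃ v, {x | T.coverMk x v ∈ A} ×ˢ {v} := by
    ext ⟨x, v⟩
    simp only [Set.mem_iUnion, Set.mem_prod, Set.mem_ofPred_eq, Set.mem_singleton_iff,
      exists_eq_right']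
    rfl
  change IsOpen (Quot.mk T.CoverRel ⁻¹' A)
  exact h ▸ isOpen_iUnion fun v => (hA v).prod (isOpen_discrete _)

lemma Holonomy.coverMk_map (H : T.Holonomy F s t g) (ha : carrier a ⊆ F) (v : Fin (n + 1)) :
    T.coverMk ⟨t, map g a⟩ (g v) = T.coverMk ⟨s, a⟩ v := by
  induction H with
  | refl => simp
  | @step t g _ l hl ih =>
    refine ih ▸ (Quot.sound ⟨g l, ?_, rfl, fun j => ?_, rfl⟩).symm
    · simpa using mt (@ha l) hl
    · dsimp only
      rw [map_perm_mul, map_perm_apply]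

lemma coverMk_eq_iff {v w : Fin (n + 1)} :
    T.coverMk ⟨s, a⟩ v = T.coverMk ⟨t, b⟩ w ↔
      ∃ g, T.Holonomy (carrier a) s t g ∧ map g a = b ∧ g v = w := by
  refine ⟨fun h => ?_, ?_⟩
  · have key : ∀ x, Relation.ReflTransGen T.CoverRel (⟨s, a⟩, v) x →
        ∃ g, T.Holonomy (carrier a) s x.1.1 g ∧ map g a = x.1.2 ∧ g v = x.2 := by
      intro x hx
      induction hx with
      | refl => exact ⟨1, .refl, by simp, rfl⟩
      | @tail y z _ hyz ih =>
        obtain ⟨⟨y, y'⟩, w⟩ := y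
        obtain ⟨⟨z, z'⟩, w'⟩ := z
        obtain ⟨g, hg, rfl, rfl⟩ := ih
        obtain ⟨i, hi, rfl, hz, rfl⟩ := hyz
        obtain ⟨l, rfl⟩ := g.surjective i
        exact ⟨_, hg.step (by simpa using hi),
          by simpa only [map_perm_mul, map_perm_eq_iff] using hz, rfl⟩
    exact key _ (quot_mk_eq_iff_reflTransGen.mp h)
  · rintro ⟨g, hg, rfl, rfl⟩
    exact (hg.coverMk_map subset_rfl v).symm

lemma LocallyTrivial.coverMk_injective (ha : T.LocallyTrivial s a) :
    Function.Injective (T.coverMk ⟨s, a⟩) := by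
  intro v w h
  obtain ⟨g, hg, hga, rfl⟩ := coverMk_eq_iff.mp h
  rw [ha g hg hga, Equiv.Perm.one_apply]

section Sheet

variable {ε : ℝ} {l : Fin (n + 1)}

variable (T) in
/-- The sheet over a star neighbourhood which contains the vertex `l` over the centre. -/
def sheet (s : ι) (a : stdSimplex ℝ (Fin (n + 1))) (ε : ℝ) (l : Fin (n + 1)) :
    Set T.VertexCover :=
  {e | ∃ x g, T.Near s a ε x g ∧ T.coverMk x (g l) = e}

lemma coverMk_mem_sheet_iff (hε : Separates a ε) {x : T.Simplices} {v : Fin (n + 1)} :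
    T.coverMk x v ∈ T.sheet s a ε l ↔ ∃ g, T.Near s a ε x g ∧ g l = v := by
  constructor
  · rintro ⟨y, g, hg, e⟩
    obtain ⟨h, hh, hx, rfl⟩ := coverMk_eq_iff.mp e
    have := hg.move hε hh
    rw [hx] at this
    exact ⟨_, this, rfl⟩
  · rintro ⟨g, hg, rfl⟩
    exact ⟨x, g, hg, rfl⟩

lemma isOpen_iff_isOpen_preimage_inter_sheet (hε : Separates a ε) {W : Set T.Space}
    (hW : W ⊆ T.star s a ε) : IsOpen W ↔ IsOpen (T.coverProj ⁻¹' W ∩ T.sheet s a ε l) := by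
  have slice (v : Fin (n + 1)) : {x | T.coverMk x v ∈ T.coverProj ⁻¹' W ∩ T.sheet s a ε l} =
      T.proj ⁻¹' W ∩ ⋃ (g : Equiv.Perm (Fin (n + 1))) (_ : g l = v), {x | T.Near s a ε x g} := by
    ext x
    simp [coverMk_mem_sheet_iff hε, and_comm]
  rw [isOpen_vertexCover_iff]
  constructor
  · intro hWo v
    rw [slice]
    exact (hWo.preimage T.continuous_proj).inter <|
      isOpen_iUnion fun g => isOpen_iUnion fun _ => isOpen_near s a ε g
  · intro ho
    have h : T.proj ⁻¹' W = ⋃ v, {x | T.coverMk x v ∈ T.coverProj ⁻¹' W ∩ T.sheet s a ε l} := by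
      ext x
      refine ⟨fun hx => ?_, fun hx => (Set.mem_iUnion.mp hx).choose_spec.1⟩
      obtain ⟨g, hg⟩ := (proj_mem_star_iff hε).mp (hW hx)
      exact Set.mem_iUnion.mpr ⟨g l, hx, x, g, hg, rfl⟩
    change IsOpen (T.proj ⁻¹' W)
    exact h ▸ isOpen_iUnion ho

lemma LocallyTrivial.injOn_coverProj_sheet (ha : T.LocallyTrivial s a) (hε : Separates a ε) :
    Set.InjOn T.coverProj (T.sheet s a ε l) := by
  rintro _ ⟨⟨t, b⟩, g, hg, rfl⟩ _ ⟨⟨u, c⟩, g', hg', rfl⟩ h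
  obtain ⟨h, hh, rfl⟩ := proj_eq_iff.mp h
  rw [← (hg.move hε hh).eq hε ha hg']
  exact (hh.coverMk_map subset_rfl _).symm

lemma surjOn_coverProj_sheet : Set.SurjOn T.coverProj (T.sheet s a ε l) (T.star s a ε) := by
  rintro _ ⟨x, ⟨g, hg⟩, rfl⟩
  exact ⟨T.coverMk x (g l), ⟨x, g, hg, rfl⟩, rfl⟩

lemma LocallyTrivial.pairwise_disjoint_sheet (ha : T.LocallyTrivial s a) (hε : Separates a ε) :
    Pairwise (Function.onFun Disjoint (T.sheet s a ε)) := by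
  intro l l' hne
  rw [Function.onFun, Set.disjoint_left]
  rintro _ ⟨x, g, hg, rfl⟩ h
  obtain ⟨g', hg', e⟩ := (coverMk_mem_sheet_iff hε).mp h
  rw [hg.eq hε ha hg'] at e
  exact hne (g'.injective e.symm)

lemma preimage_star_subset_iUnion_sheet (hε : Separates a ε) :
    T.coverProj ⁻¹' T.star s a ε ⊆ ⋃ l, T.sheet s a ε l := by
  intro e he
  obtain ⟨x, v, rfl⟩ := exists_coverMk_eq e
  obtain ⟨g, hg⟩ := (proj_mem_star_iff hε).mp he
  exact Set.mem_iUnion.mpr ⟨g.symm v, x, g, hg, by rw [Equiv.apply_symm_apply]⟩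

lemma LocallyTrivial.isEvenlyCovered (ha : T.LocallyTrivial s a) :
    IsEvenlyCovered T.coverProj (T.proj ⟨s, a⟩) (Fin (n + 1)) := by
  obtain ⟨ε, hε⟩ := exists_separates a
  have : Nonempty (T.Space → T.VertexCover) := ⟨fun _ => T.coverMk ⟨s, a⟩ 0⟩
  exact .of_trivialization (t := (isOpen_star hε).trivializationDiscrete (T.sheet s a ε) _
    (fun _ _ => isOpen_iff_isOpen_preimage_inter_sheet hε) (fun _ => ha.injOn_coverProj_sheet hε)
    (fun _ => surjOn_coverProj_sheet) (ha.pairwise_disjoint_sheet hε)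
    (preimage_star_subset_iUnion_sheet hε)) (proj_mem_star_self hε.pos)

end Sheet

variable (T) in
/-- The set of points where the triangulation is locally trivial. -/
def trivialLocus : Set T.Space :=
  {x | ∃ s a, T.LocallyTrivial s a ∧ T.proj ⟨s, a⟩ = x}

lemma isCoveringMap_restrictPreimage {S : Set T.Space} (hS : S ⊆ T.trivialLocus) :
    IsCoveringMap (S.restrictPreimage T.coverProj) := by
  have : IsCoveringMapOn T.coverProj S := by
    intro x hx
    obtain ⟨s, a, ha, rfl⟩ := hS hx
    exact ha.isEvenlyCovered.to_isEvenlyCovered_preimage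
  exact this.isCoveringMap_restrictPreimage

/-! ### Lifts of paths -/

/-- The path `γ` from the image of `c` to the image of `d` lifts to the vertex cover in such a way
that the vertices of the simplex containing `c` are moved by `g`. -/
def Lifts {S : Set T.Space} {x y : S} (γ : Path x y) (c d : T.Simplices)
    (g : Equiv.Perm (Fin (n + 1))) : Prop :=
  ∀ v, ∃ Γ : Path (T.coverMk c v) (T.coverMk d (g v)), ∀ r, T.coverProj (Γ r) = γ r

namespace Lifts

variable {S : Set T.Space} {x y z : S} {γ : Path x y} {c d e : T.Simplices}

lemma refl (h : T.proj c = x) : T.Lifts (Path.refl x) c c 1 :=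
  fun _ => ⟨Path.refl _, fun _ => h⟩

lemma trans {γ' : Path y z} (H : T.Lifts γ c d g) (H' : T.Lifts γ' d e h) :
    T.Lifts (γ.trans γ') c e (h * g) := by
  intro v
  obtain ⟨Γ, hΓ⟩ := H v
  obtain ⟨Γ', hΓ'⟩ := H' (g v)
  rw [Equiv.Perm.mul_apply]
  refine ⟨Γ.trans Γ', fun r => ?_⟩
  rw [Path.trans_apply, Path.trans_apply]
  split_ifs
  · exact hΓ _
  · exact hΓ' _

lemma symm (H : T.Lifts γ c d g) : T.Lifts γ.symm d c g⁻¹ := by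
  intro v
  obtain ⟨Γ, hΓ⟩ := H (g⁻¹ v)
  exact ⟨Γ.symm.cast (by simp) rfl, fun r => hΓ _⟩

lemma cast {x' y' : S} (hx : x' = x) (hy : y' = y) (H : T.Lifts γ c d g) :
    T.Lifts (γ.cast hx hy) c d g :=
  H

lemma of_path (δ : Path a b) (h : ∀ r, (γ r : T.Space) = T.proj ⟨s, δ r⟩) :
    T.Lifts γ ⟨s, a⟩ ⟨s, b⟩ 1 := by
  refine fun v => ⟨⟨⟨fun r => T.coverMk ⟨s, δ r⟩ v, ?_⟩, ?_, ?_⟩, fun r => (h r).symm⟩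
  · exact (continuous_coverMk v).comp (continuous_sigmaMk.comp δ.continuous)
  · simp
  · simp

lemma move (H : T.Lifts γ c ⟨s, b⟩ g) (K : T.Holonomy (carrier b) s t h) :
    T.Lifts γ c ⟨t, map h b⟩ (h * g) := by
  intro v
  obtain ⟨Γ, hΓ⟩ := H v
  exact ⟨Γ.cast rfl (K.coverMk_map subset_rfl (g v)), hΓ⟩

lemma monodromy_eq (H : T.Lifts γ c d g) (hS : S ⊆ T.trivialLocus) (v : Fin (n + 1))
    (hc : T.proj c ∈ S) (hd : T.proj d ∈ S) (hx : (⟨T.proj c, hc⟩ : S) = x)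
    (hy : (⟨T.proj d, hd⟩ : S) = y) :
    (isCoveringMap_restrictPreimage hS).monodromy (.mk γ) ⟨⟨T.coverMk c v, hc⟩, hx⟩
      = ⟨⟨T.coverMk d (g v), hd⟩, hy⟩ := by
  obtain ⟨Γ, hΓ⟩ := H v
  have hmem (r) : Γ r ∈ T.coverProj ⁻¹' S := by
    rw [Set.mem_preimage, hΓ]
    exact (γ r).2
  let Γ' : Path (⟨T.coverMk c v, hc⟩ : T.coverProj ⁻¹' S) ⟨T.coverMk d (g v), hd⟩ :=
    { toFun r := ⟨Γ r, hmem r⟩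
      continuous_toFun := Γ.continuous.subtype_mk hmem
      source' := Subtype.ext Γ.source
      target' := Subtype.ext Γ.target }
  refine (isCoveringMap_restrictPreimage hS).monodromy_eq_of_map_eq (.mk Γ') ?_
  refine congrArg Path.Homotopic.Quotient.mk ?_
  ext r
  exact hΓ r

lemma eq_one_of_simplyConnected [SimplyConnectedSpace S] (hS : S ⊆ T.trivialLocus)
    (ha : T.LocallyTrivial s a) (hx : T.proj ⟨s, a⟩ = x) (hy : T.proj ⟨s, a⟩ = y)
    (H : T.Lifts γ ⟨s, a⟩ ⟨s, a⟩ g) : g = 1 := by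
  obtain rfl : x = y := Subtype.ext (hx.symm.trans hy)
  have hmem : T.proj ⟨s, a⟩ ∈ S := hx ▸ x.2
  ext1 v
  have h₁ := H.monodromy_eq hS v hmem hmem (Subtype.ext hx) (Subtype.ext hx)
  have h₂ := (refl hx).monodromy_eq hS v hmem hmem (Subtype.ext hx) (Subtype.ext hx)
  rw [Subsingleton.elim (Path.Homotopic.Quotient.mk γ) (.mk (.refl x)), h₂] at h₁
  exact (ha.coverMk_injective (congrArg (fun e => e.1.1) h₁)).symm

end Lifts

/-! ### Links -/

/-- The normal slice to the face spanned by `F`, which appears in the definition of the links. -/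
def slice (F : Finset (Fin (n + 1))) : Set (stdSimplex ℝ (Fin (n + 1))) :=
  {a | ∀ i ∈ F, a i = (n / (n + 1) : ℝ) / F.card}

lemma mix_mem_slice (ha : a ∈ slice F) (hb : b ∈ slice F) (r : unitInterval) :
    mix a b r ∈ slice F := by
  intro i hi
  rw [mix_apply, ha i hi, hb i hi]
  ring

lemma map_perm_mem_slice (hb : b ∈ slice F) (g : Equiv.Perm (Fin (n + 1))) :
    map g b ∈ slice (g • F) := by
  intro i hi
  obtain ⟨i, rfl⟩ := g.surjective i
  rw [map_perm_apply, hb i (apply_mem_smul_finset_iff.mp hi), Finset.card_smul_finset]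

lemma card_lt_card_carrier_of_mem_slice (hn : n ≠ 0) (hF : F.Nonempty) (hb : b ∈ slice F) :
    F.card < (carrier b).card := by
  have hF₀ : (F.card : ℝ) ≠ 0 := by simpa using hF.ne_empty
  have hsub : F ⊆ carrier b := fun j hj => by
    rw [mem_carrier, hb j hj]
    positivity
  refine Finset.card_lt_card (hsub.ssubset_of_ne fun hne => ?_)
  have hsum : ∑ j ∈ F, b j = 1 := by
    rw [← sum_eq_one b]
    refine Finset.sum_subset (Finset.subset_univ _) fun j _ hj => ?_
    simpa [hne] using hj
  rw [Finset.sum_congr rfl hb, Finset.sum_const, nsmul_eq_mul] at hsum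
  field_simp at hsum
  linarith

lemma exists_mem_slice (hn : n ≠ 0) {A : Finset (Fin (n + 1))} (hF : F.Nonempty)
    (hA : A.Nonempty) (hFA : Disjoint F A) :
    ∃ b ∈ slice F, carrier b = F ∪ A ∧ ∀ j ∈ A, b j = (1 / (n + 1) : ℝ) / A.card := by
  have hF₀ : (F.card : ℝ) ≠ 0 := by simpa using hF.ne_empty
  have hA₀ : (A.card : ℝ) ≠ 0 := by simpa using hA.ne_empty
  obtain ⟨b, hb⟩ : ∃ b : stdSimplex ℝ (Fin (n + 1)), ∀ j,
      b j = (if j ∈ F then (n / (n + 1) : ℝ) / F.card else 0)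
        + if j ∈ A then (1 / (n + 1) : ℝ) / A.card else 0 := by
    refine ⟨⟨fun j => (if j ∈ F then (n / (n + 1) : ℝ) / F.card else 0)
        + if j ∈ A then (1 / (n + 1) : ℝ) / A.card else 0, fun j => ?_, ?_⟩, fun j => rfl⟩
    · dsimp only
      split_ifs <;> positivity
    · rw [Finset.sum_add_distrib, Finset.sum_ite_mem, Finset.sum_ite_mem, Finset.univ_inter,
        Finset.univ_inter, Finset.sum_const, Finset.sum_const, nsmul_eq_mul, nsmul_eq_mul]
      field_simp
  have hbF : b ∈ slice F := fun j hj => by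
    rw [hb, if_pos hj, if_neg (Finset.disjoint_left.mp hFA hj), add_zero]
  have hbA : ∀ j ∈ A, b j = (1 / (n + 1) : ℝ) / A.card := fun j hj => by
    rw [hb, if_pos hj, if_neg (Finset.disjoint_right.mp hFA hj), zero_add]
  refine ⟨b, hbF, ?_, hbA⟩
  ext j
  rw [mem_carrier, Finset.mem_union]
  refine ⟨fun h => ?_, ?_⟩
  · contrapose! h
    rw [hb, if_neg h.1, if_neg h.2, add_zero]
  · rintro (hj | hj)
    · rw [hbF j hj]
      positivity
    · rw [hbA j hj]
      positivity

lemma Holonomy.proj_mem_link (H : T.Holonomy F s t g) (hb : b ∈ slice F) :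
    T.proj ⟨t, map g b⟩ ∈ T.link s F :=
  ⟨⟨t, map g b⟩, ⟨g • F, H.singlex_eq, map_perm_mem_slice hb g⟩, rfl⟩

lemma link_subset_trivialLocus (hn : n ≠ 0) (hF : F.Nonempty) (s : ι)
    (h : ∀ t (b : stdSimplex ℝ (Fin (n + 1))), F.card < (carrier b).card → T.LocallyTrivial t b) :
    T.link s F ⊆ T.trivialLocus := by
  rintro _ ⟨⟨t, b⟩, ⟨F', hF', hb⟩, rfl⟩
  obtain ⟨g, -, rfl⟩ := (singlex_eq_iff hF).mp hF'
  refine ⟨t, b, h t b ?_, rfl⟩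
  rw [← Finset.card_smul_finset g F]
  exact card_lt_card_carrier_of_mem_slice hn hF.smul_finset hb

lemma exists_lifts_segment {S : Set T.Space} (h : ∀ r, T.proj ⟨s, mix a b r⟩ ∈ S) {x y : S}
    (hx : T.proj ⟨s, a⟩ = x) (hy : T.proj ⟨s, b⟩ = y) :
    ∃ γ : Path x y, T.Lifts γ ⟨s, a⟩ ⟨s, b⟩ 1 := by
  let δ : Path a b := ⟨⟨mix a b, continuous_mix.comp (by fun_prop :
    Continuous fun r => ((a, b), r))⟩, mix_zero a b, mix_one a b⟩
  refine ⟨⟨⟨fun r => ⟨T.proj ⟨s, δ r⟩, h r⟩, ?_⟩, Subtype.ext ?_, Subtype.ext ?_⟩,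
    Lifts.of_path δ fun r => rfl⟩
  · exact (T.continuous_proj.comp (continuous_sigmaMk.comp δ.continuous)).subtype_mk h
  · simp [hx]
  · simp [hy]

lemma Holonomy.exists_lifts_link (hF : F.Nonempty) (hF' : F.card + 2 ≤ n)
    (H : T.Holonomy F s t g) (hb : b ∈ slice F) {x : T.link s F} (hx : T.proj ⟨s, b⟩ = x) :
    ∃ (y : T.link s F) (γ : Path x y), T.proj ⟨t, map g b⟩ = y ∧
      T.Lifts γ ⟨s, b⟩ ⟨t, map g b⟩ g := by
  induction H with
  | refl => exact ⟨x, Path.refl x, by simpa using hx, by simpa using Lifts.refl hx⟩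
  | @step t g H l hl ih =>
    obtain ⟨y, γ, hy, hγ⟩ := ih
    have hA : (Fᶜ.erase l).Nonempty := by
      rw [← Finset.card_pos, Finset.card_erase_of_mem (by simpa using hl), Finset.card_compl,
        Fintype.card_fin]
      omega
    obtain ⟨c, hc, hcarrier, -⟩ := exists_mem_slice (by omega) hF hA
      (disjoint_compl_right.mono_right (Finset.erase_subset l _))
    have hlc : g l ∉ carrier (map g c) := by
      simp [carrier_map_perm, hcarrier, hl]
    have K := Holonomy.single (T := T) (s := t) hlc
    have H' := H.step hl
    obtain ⟨γ₁, h₁⟩ := exists_lifts_segment (b := map g c)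
      (fun r => map_perm_mix g b c r ▸ H.proj_mem_link (mix_mem_slice hb hc r)) hy
      (y := (⟨_, H.proj_mem_link hc⟩ : T.link s F)) rfl
    obtain ⟨γ₂, h₂⟩ := exists_lifts_segment
      (fun r => map_perm_mix (T.glue t (g l) * g) c b r ▸
        H'.proj_mem_link (mix_mem_slice hc hb r))
      (x := (⟨_, H.proj_mem_link hc⟩ : T.link s F))
      (y := (⟨_, H'.proj_mem_link hb⟩ : T.link s F))
      ((map_perm_mul _ g c).symm ▸ K.proj_map subset_rfl) rfl
    have hγ₁ := (hγ.trans h₁).move K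
    rw [← map_perm_mul] at hγ₁
    exact ⟨_, (γ.trans γ₁).trans γ₂, rfl, by simpa using hγ₁.trans h₂⟩

/-- The lift to the vertex cover of a loop in the link is governed by the holonomy around the
singlex, so that simple connectivity of the link kills the holonomy. -/
lemma locallyTrivial_of_link (hcard : (carrier a).card + 2 ≤ n)
    (hlink : SimplyConnectedSpace (T.link s (carrier a)))
    (h : ∀ t (b : stdSimplex ℝ (Fin (n + 1))),
      (carrier a).card < (carrier b).card → T.LocallyTrivial t b) :
    T.LocallyTrivial s a := by
  intro g H hg
  have hn : n ≠ 0 := by omega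
  have hcompl : (carrier a)ᶜ.Nonempty := by
    rw [← Finset.card_pos, Finset.card_compl, Fintype.card_fin]
    omega
  obtain ⟨b, hb, hcarrier, hval⟩ :=
    exists_mem_slice hn (carrier_nonempty a) hcompl disjoint_compl_right
  rw [Finset.union_compl] at hcarrier
  have hgb : map g b = b := by
    have hmem : ∀ j, g j ∈ carrier a ↔ j ∈ carrier a := fun j => by
      rw [mem_carrier, mem_carrier, map_perm_eq_iff.mp hg]
    refine map_perm_eq_iff.mpr fun j => ?_
    by_cases hj : j ∈ carrier a
    · rw [hb j hj, hb _ ((hmem j).mpr hj)]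
    · rw [hval j (by simpa using hj), hval _ (by simpa using mt (hmem j).mp hj)]
  have hx : T.proj ⟨s, b⟩ ∈ T.link s (carrier a) := by
    simpa using (Holonomy.refl (T := T) (F := carrier a) (s := s)).proj_mem_link hb
  obtain ⟨y, γ, hy, hγ⟩ := H.exists_lifts_link (carrier_nonempty a) hcard hb (x := ⟨_, hx⟩) rfl
  rw [hgb] at hy hγ
  exact hγ.eq_one_of_simplyConnected (link_subset_trivialLocus hn (carrier_nonempty a) s h)
    (locallyTrivial_of_carrier_eq_univ hcarrier) rfl hy

lemma locallyTrivial_of_card_compl_le_two (hn : 2 ≤ n) (hT : T.IsEven)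
    (hinj : 4 ≤ n → T.InjectiveOnInteriors) (ha : (carrier a)ᶜ.card ≤ 2) :
    T.LocallyTrivial s a := by
  interval_cases h : (carrier a)ᶜ.card
  · exact locallyTrivial_of_carrier_eq_univ (by simpa using h)
  · obtain ⟨i, hi⟩ := Finset.card_eq_one.mp h
    exact locallyTrivial_of_carrier_eq_compl_singleton (compl_eq_comm.mp hi).symm
  · obtain ⟨i, j, hij, hi⟩ := Finset.card_eq_two.mp h
    exact locallyTrivial_of_codim_two hn hT hinj hij (compl_eq_comm.mp hi).symm

lemma locallyTrivial_of_two_le_card_carrier (hn : 2 ≤ n) (hT : T.IsEven)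
    (hT' : 4 ≤ n → T.InjectiveOnInteriors ∧ T.LinksSimplyConnected)
    (ha : 2 ≤ (carrier a).card) : T.LocallyTrivial s a := by
  induction hk : (carrier a)ᶜ.card using Nat.strong_induction_on generalizing s a with
  | _ k ih =>
    have hcard (c : stdSimplex ℝ (Fin (n + 1))) : (carrier c)ᶜ.card + (carrier c).card = n + 1 := by
      rw [Finset.card_compl_add_card, Fintype.card_fin]
    have hcard_a := hcard a
    rcases le_or_gt (carrier a)ᶜ.card 2 with h | h
    · exact locallyTrivial_of_card_compl_le_two hn hT (fun h4 => (hT' h4).1) h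
    · have ha' : (carrier a).card + 2 ≤ n := by omega
      refine locallyTrivial_of_link ha' ((hT' (by omega)).2 s _ ha ha') fun t b hb => ?_
      have hcard_b := hcard b
      exact ih _ (by omega) (by omega) rfl

lemma two_le_card_carrier (ha : ∀ j, a j < 1) : 2 ≤ (carrier a).card := by
  by_contra! h
  obtain ⟨j, hj⟩ := Finset.card_eq_one.mp
    (le_antisymm (Nat.lt_succ_iff.mp h) (carrier_nonempty a).card_pos)
  refine (ha j).ne ?_
  rw [← sum_eq_one a]
  refine (Finset.sum_eq_single j (fun k _ hk => ?_) (by simp)).symm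
  have hk' : k ∉ carrier a := by rwa [hj, Finset.mem_singleton]
  simpa using hk'

/-! ### The canonical symmetric representation -/

lemma exists_coverMk_eq_of_coverProj_eq {e : T.VertexCover} (h : T.coverProj e = T.proj ⟨s, a⟩) :
    ∃ v, T.coverMk ⟨s, a⟩ v = e := by
  obtain ⟨⟨t, b⟩, w, rfl⟩ := exists_coverMk_eq e
  obtain ⟨g, hg, rfl⟩ := proj_eq_iff.mp h.symm
  obtain ⟨v, rfl⟩ := g.surjective w
  exact ⟨v, (hg.coverMk_map subset_rfl v).symm⟩

/-- The identification of the vertices of a simplex with the fibre of the vertex cover over one of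
its points. -/
def LocallyTrivial.fiberEquiv (ha : T.LocallyTrivial s a) {S : Set T.Space}
    (hS : T.proj ⟨s, a⟩ ∈ S) :
    Fin (n + 1) ≃ (S.restrictPreimage T.coverProj ⁻¹' {⟨T.proj ⟨s, a⟩, hS⟩}) :=
  Equiv.ofBijective (fun v => ⟨⟨T.coverMk ⟨s, a⟩ v, hS⟩, rfl⟩) <| by
    refine ⟨fun v w h => ha.coverMk_injective (congrArg (fun e => e.1.1) h), fun ⟨⟨e, he⟩, h⟩ => ?_⟩
    obtain ⟨v, rfl⟩ := exists_coverMk_eq_of_coverProj_eq (congrArg Subtype.val h)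
    exact ⟨v, rfl⟩

lemma carrier_barycenter :
    carrier (barycenter : stdSimplex ℝ (Fin (n + 1))) = Finset.univ := by
  refine Finset.eq_univ_of_forall fun j => ?_
  have h : (barycenter : stdSimplex ℝ (Fin (n + 1))) j = (Fintype.card (Fin (n + 1)) : ℝ)⁻¹ :=
    barycenter_apply j
  rw [mem_carrier, h, Fintype.card_fin]
  positivity

lemma proj_mem_skeleton_zero_iff : T.proj ⟨s, a⟩ ∈ T.skeleton 0 ↔ ∃ j, a j = 1 := by
  refine ⟨T.exists_eq_one_of_mem_skeleton_zero, ?_⟩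
  rintro ⟨j, hj⟩
  simp only [skeleton, Set.mem_iUnion]
  refine ⟨s, {j}, rfl, ⟨s, a⟩, ⟨rfl, fun i hi => ?_⟩, rfl⟩
  rw [eq_vertex_of_apply_eq_one hj]
  exact Pi.single_eq_of_ne (by simpa using hi) 1

lemma proj_mem_compl_skeleton_zero_iff : T.proj ⟨s, a⟩ ∈ (T.skeleton 0)ᶜ ↔ ∀ j, a j < 1 := by
  rw [Set.mem_compl_iff, proj_mem_skeleton_zero_iff, not_exists]
  exact forall_congr' fun j => (le_one a j).lt_iff_ne.symm

lemma map_glue_facetBarycenter (hn : 3 ≤ n) (s : ι) (i : Fin (n + 1)) :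
    map (T.glue s i) (facetBarycenter hn i) = facetBarycenter hn (T.glue s i i) := by
  refine map_perm_eq_iff.mpr fun j => ?_
  change (if T.glue s i j = T.glue s i i then (0 : ℝ) else _) = if j = i then 0 else _
  simp

lemma notMem_carrier_facetBarycenter (hn : 3 ≤ n) (i : Fin (n + 1)) :
    i ∉ carrier (facetBarycenter hn i) := by
  rw [mem_carrier, not_not]
  exact if_pos rfl

lemma lifts_halfEdge (hn : 3 ≤ n) (s : ι) (i : Fin (n + 1)) :
    T.Lifts (T.halfEdge hn s i) ⟨s, barycenter⟩ ⟨s, facetBarycenter hn i⟩ 1 :=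
  Lifts.of_path ⟨⟨spoke hn i, continuous_spoke hn i⟩, spoke_zero hn i, spoke_one hn i⟩
    fun _ => rfl

lemma lifts_dualEdge (hn : 3 ≤ n) (s : ι) (i : Fin (n + 1)) :
    T.Lifts (T.dualEdge hn s i) ⟨s, barycenter⟩ ⟨T.adj s i, barycenter⟩ (T.glue s i) := by
  have cross := (lifts_halfEdge (T := T) hn s i).move
    (.single (notMem_carrier_facetBarycenter hn i))
  rw [map_glue_facetBarycenter] at cross
  have back := (lifts_halfEdge (T := T) hn (T.adj s i) (T.glue s i i)).symm.cast
    (T.facetCenter_adj hn s i).symm rfl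
  have h := cross.trans back
  rw [inv_one, one_mul, mul_one] at h
  exact h

lemma FacetPath.lifts_dualPath (hn : 3 ≤ n) (γ : T.FacetPath s t) :
    T.Lifts (γ.dualPath hn) ⟨s, barycenter⟩ ⟨t, barycenter⟩ γ.projectivity := by
  induction γ with
  | nil s => exact Lifts.refl rfl
  | cons s i γ ih => exact (lifts_dualEdge hn s i).trans ih

/-- The representation is the monodromy of the vertex cover. -/
lemma exists_isCanonicalRepresentation (hn : 3 ≤ n)
    (hT : ∀ (s : ι) (a : stdSimplex ℝ (Fin (n + 1))), (∀ j, a j < 1) → T.LocallyTrivial s a)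
    (s : ι) : ∃ ρ, T.IsCanonicalRepresentation hn s ρ := by
  have hS : (T.skeleton 0)ᶜ ⊆ T.trivialLocus := by
    intro x hx
    obtain ⟨s, a, rfl⟩ := exists_proj_eq x
    exact ⟨s, a, hT s a (proj_mem_compl_skeleton_zero_iff.mp hx), rfl⟩
  have hs := (T.center hn s).2
  let e := (locallyTrivial_of_carrier_eq_univ (T := T) (s := s) carrier_barycenter).fiberEquiv hs
  refine ⟨(e.symm.permCongrHom.toMonoidHom).comp
    ((isCoveringMap_restrictPreimage hS).monodromyPerm (T.center hn s)), fun γ => ?_⟩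
  ext1 v
  change e.symm ((isCoveringMap_restrictPreimage hS).monodromy (.mk (γ.dualPath hn)) (e v)) = _
  rw [Equiv.symm_apply_eq]
  exact (γ.lifts_dualPath hn).monodromy_eq hS v hs hs rfl rfl

/-! ### Dual paths -/

lemma carrier_mix_subset (r : unitInterval) : carrier (mix a b r) ⊆ carrier a ∪ carrier b := by
  intro j
  rw [Finset.mem_union, mem_carrier, mem_carrier, mem_carrier]
  contrapose!
  rintro ⟨ha, hb⟩
  rw [mix_apply, ha, hb, mul_zero, mul_zero, add_zero]

/-- The standard simplex without its vertices. -/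
abbrev Core (n : ℕ) : Type := {a : stdSimplex ℝ (Fin (n + 1)) // ∀ j, a j < 1}

namespace Core

/-- The point at time `r` on the straight segment from `a` to `b`. -/
def mix (a b : Core n) (r : unitInterval) : Core n := by
  refine ⟨SingularTriangulation.mix a.1 b.1 r, fun j => ?_⟩
  rw [mix_apply]
  exact convex_Iio (1 : ℝ) (a.2 j) (b.2 j) (sub_nonneg.mpr r.2.2) r.2.1 (sub_add_cancel _ _)

lemma continuous_mix :
    Continuous fun p : (Core n × Core n) × unitInterval => mix p.1.1 p.1.2 p.2 :=
  (SingularTriangulation.continuous_mix.comp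
    (by fun_prop : Continuous fun p : (Core n × Core n) × unitInterval =>
      ((p.1.1.1, p.1.2.1), p.2))).subtype_mk _

/-- The straight segment, as a path. -/
def segment (a b : Core n) : Path a b where
  toFun := mix a b
  continuous_toFun := continuous_mix.comp
    (by fun_prop : Continuous fun r : unitInterval => ((a, b), r))
  source' := Subtype.ext (mix_zero _ _)
  target' := Subtype.ext (mix_one _ _)

instance (a b : Core n) : Subsingleton (Path.Homotopic.Quotient a b) := by
  have : ContractibleSpace (Core n) := by
    rw [contractible_iff_id_nullhomotopic]
    refine ⟨a, ⟨⟨⟨fun p => mix p.2 a p.1, ?_⟩, fun x => Subtype.ext (mix_zero _ _),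
      fun x => Subtype.ext (mix_one _ _)⟩⟩⟩
    exact continuous_mix.comp
      (by fun_prop : Continuous fun p : unitInterval × Core n => ((p.2, a), p.1))
  infer_instance

/-- Relabelling of the vertices. -/
def map (g : Equiv.Perm (Fin (n + 1))) (a : Core n) : Core n := by
  refine ⟨stdSimplex.map g a.1, fun j => ?_⟩
  obtain ⟨j, rfl⟩ := g.surjective j
  exact (map_perm_apply g a.1 j).trans_lt (a.2 j)

lemma map_mul (g h : Equiv.Perm (Fin (n + 1))) (a : Core n) : a.map (g * h) = (a.map h).map g :=
  Subtype.ext (map_perm_mul g h a.1)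

/-- The barycentre. -/
def center (hn : 3 ≤ n) : Core n := by
  refine ⟨barycenter, fun j => ?_⟩
  have h : (barycenter : stdSimplex ℝ (Fin (n + 1))) j = (Fintype.card (Fin (n + 1)) : ℝ)⁻¹ :=
    barycenter_apply j
  rw [h, Fintype.card_fin]
  exact inv_lt_one_of_one_lt₀ (by exact_mod_cast (by omega : 1 < n + 1))

/-- The barycentre of the facet opposite to the vertex `i`. -/
def facetCenter (hn : 3 ≤ n) (i : Fin (n + 1)) : Core n := by
  refine ⟨facetBarycenter hn i, fun j => ?_⟩
  change (if j = i then (0 : ℝ) else (n : ℝ)⁻¹) < 1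
  split_ifs
  · exact one_pos
  · exact inv_lt_one_of_one_lt₀ (by exact_mod_cast (by omega : 1 < n))

end Core

variable {p q r : Core n} {x y z : T.Punctured}

variable (T) in
/-- The map of a simplex without its vertices to the complement of the vertices. -/
def pt (s : ι) : C(Core n, T.Punctured) where
  toFun a := ⟨T.proj ⟨s, a.1⟩, proj_mem_compl_skeleton_zero_iff.mpr a.2⟩
  continuous_toFun := Continuous.subtype_mk
    (T.continuous_proj.comp (continuous_sigmaMk.comp continuous_subtype_val)) _

lemma exists_pt_eq (x : T.Punctured) : ∃ s p, T.pt s p = x := by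
  obtain ⟨x, hx⟩ := x
  obtain ⟨s, a, rfl⟩ := exists_proj_eq x
  exact ⟨s, ⟨a, proj_mem_compl_skeleton_zero_iff.mp hx⟩, rfl⟩

lemma pt_center (hn : 3 ≤ n) (s : ι) : T.pt s (Core.center hn) = T.center hn s := rfl

lemma pt_facetCenter (hn : 3 ≤ n) (s : ι) (i : Fin (n + 1)) :
    T.pt s (Core.facetCenter hn i) = T.facetCenter hn s i := rfl

lemma Holonomy.pt_map (H : T.Holonomy F s t g) (hp : carrier p.1 ⊆ F) :
    T.pt t (p.map g) = T.pt s p :=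
  Subtype.ext (H.proj_map hp)

variable (T) in
/-- The class of the straight segment from `p` to `q` in the simplex `s`. The end points `x` and `y`
are kept apart from `T.pt s p` and `T.pt s q`, because classes in different simplices are to be
composed. -/
def line (s : ι) (p q : Core n) (hx : T.pt s p = x) (hy : T.pt s q = y) :
    Path.Homotopic.Quotient x y :=
  .mk (((Core.segment p q).map (T.pt s).continuous).cast hx.symm hy.symm)

lemma mk_map_eq_line (s : ι) (γ : Path p q) :
    .mk (γ.map (T.pt s).continuous) = T.line s p q rfl rfl :=
  congrArg (fun c => Path.Homotopic.Quotient.map c (T.pt s))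
    (Subsingleton.elim (Path.Homotopic.Quotient.mk γ) (.mk (Core.segment p q)))

lemma line_symm (hx : T.pt s p = x) (hy : T.pt s q = y) :
    (T.line s p q hx hy).symm = T.line s q p hy hx := by
  subst hx hy
  rw [← mk_map_eq_line s (Core.segment p q).symm, ← Path.map_symm]
  rfl

lemma line_self (hx : T.pt s p = x) : T.line s p p hx hx = .refl x := by
  subst hx
  exact (mk_map_eq_line s (Path.refl p)).symm

lemma line_trans_line (hx : T.pt s p = x) (hy : T.pt s q = y) (hz : T.pt s r = z) :
    (T.line s p q hx hy).trans (T.line s q r hy hz) = T.line s p r hx hz := by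
  subst hx hy hz
  rw [← mk_map_eq_line s ((Core.segment p q).trans (Core.segment q r)), Path.map_trans]
  rfl

lemma Holonomy.line_map (H : T.Holonomy F s t g) (hp : carrier p.1 ⊆ F) (hq : carrier q.1 ⊆ F)
    (hx : T.pt s p = x) (hy : T.pt s q = y) (hx' : T.pt t (p.map g) = x)
    (hy' : T.pt t (q.map g) = y) :
    T.line t (p.map g) (q.map g) hx' hy' = T.line s p q hx hy := by
  refine congrArg Path.Homotopic.Quotient.mk (Path.ext (funext fun r => Subtype.ext ?_))
  change T.proj ⟨t, mix (map g p.1) (map g q.1) r⟩ = T.proj ⟨s, mix p.1 q.1 r⟩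
  rw [← map_perm_mix]
  exact H.proj_map ((carrier_mix_subset r).trans (Finset.union_subset hp hq))

lemma mk_halfEdge (hn : 3 ≤ n) (s : ι) (i : Fin (n + 1)) :
    Path.Homotopic.Quotient.mk (T.halfEdge hn s i) =
      T.line s (Core.center hn) (Core.facetCenter hn i) (pt_center hn s) (pt_facetCenter hn s i) :=
  rfl

lemma mk_halfEdge_symm_cast (hn : 3 ≤ n) {i : Fin (n + 1)} (hx : T.facetCenter hn s i = x) :
    Path.Homotopic.Quotient.mk ((T.halfEdge hn s i).symm.cast hx.symm rfl) =
      T.line s (Core.facetCenter hn i) (Core.center hn) hx (pt_center hn s) := by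
  subst hx
  exact line_symm (pt_center hn s) (pt_facetCenter hn s i)

lemma mk_dualEdge (hn : 3 ≤ n) {i : Fin (n + 1)} (hp : i ∉ carrier p.1) (hx : T.pt s p = x)
    (hx' : T.pt (T.adj s i) (p.map (T.glue s i)) = x) :
    Path.Homotopic.Quotient.mk (T.dualEdge hn s i) =
      (T.line s (Core.center hn) p (pt_center hn s) hx).trans
        (T.line (T.adj s i) (p.map (T.glue s i)) (Core.center hn) hx' (pt_center hn _)) := by
  have hc : (Core.facetCenter hn i).map (T.glue s i) = Core.facetCenter hn (T.glue s i i) :=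
    Subtype.ext (map_glue_facetBarycenter hn s i)
  have hc' : T.pt (T.adj s i) (Core.facetCenter hn (T.glue s i i)) = T.facetCenter hn s i :=
    T.facetCenter_adj hn s i
  have cross : T.line (T.adj s i) (p.map (T.glue s i)) (Core.facetCenter hn (T.glue s i i))
      hx' hc' = T.line s p (Core.facetCenter hn i) hx (pt_facetCenter hn s i) := by
    simp only [← hc]
    have hF : T.Holonomy {i}ᶜ s (T.adj s i) (T.glue s i) := .single (by simp)
    exact hF.line_map (Finset.subset_compl_singleton.mpr hp)
      (Finset.subset_compl_singleton.mpr (notMem_carrier_facetBarycenter hn i)) _ _ _ _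
  rw [dualEdge, Path.Homotopic.Quotient.mk_trans, mk_halfEdge, mk_halfEdge_symm_cast hn hc',
    ← line_trans_line hx' hc' (pt_center hn _), cross, ← Path.Homotopic.Quotient.trans_assoc,
    line_trans_line]

lemma FacetPath.mk_dualPath_append (hn : 3 ≤ n) (γ : T.FacetPath s t) (δ : T.FacetPath t u) :
    Path.Homotopic.Quotient.mk ((γ.append δ).dualPath hn) =
      (Path.Homotopic.Quotient.mk (γ.dualPath hn)).trans (.mk (δ.dualPath hn)) := by
  induction γ with
  | nil s => exact (Path.Homotopic.Quotient.refl_trans _).symm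
  | cons s i γ ih =>
    simp only [append, dualPath, Path.Homotopic.Quotient.mk_trans, ih,
      Path.Homotopic.Quotient.trans_assoc]

lemma Holonomy.exists_mk_dualPath (hn : 3 ≤ n) (H : T.Holonomy (carrier p.1) s t g)
    (hx : T.pt s p = x) (hx' : T.pt t (p.map g) = x) :
    ∃ γ : T.FacetPath s t, Path.Homotopic.Quotient.mk (γ.dualPath hn) =
      (T.line s (Core.center hn) p (pt_center hn s) hx).trans
        (T.line t (p.map g) (Core.center hn) hx' (pt_center hn t)) := by
  induction H with
  | refl =>
    refine ⟨.nil s, ?_⟩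
    have hp : p.map 1 = p := Subtype.ext (map_perm_one _)
    simp only [hp]
    rw [line_trans_line, line_self]
    rfl
  | @step t g H l hl ih =>
    have hy : T.pt t (p.map g) = x := (H.pt_map subset_rfl).trans hx
    obtain ⟨γ, hγ⟩ := ih hy
    have hl' : g l ∉ carrier (p.map g).1 := by
      change g l ∉ carrier (map g p.1)
      rwa [carrier_map_perm, apply_mem_smul_finset_iff]
    refine ⟨γ.append (.cons t (g l) (.nil _)), ?_⟩
    simp only [Core.map_mul] at hx' ⊢
    rw [FacetPath.mk_dualPath_append, hγ, FacetPath.dualPath, FacetPath.dualPath,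
      Path.Homotopic.Quotient.mk_trans, Path.Homotopic.Quotient.mk_refl,
      Path.Homotopic.Quotient.trans_refl, mk_dualEdge hn hl' hy hx',
      Path.Homotopic.Quotient.trans_assoc,
      ← Path.Homotopic.Quotient.trans_assoc (T.line t (p.map g) (Core.center hn) _ _),
      line_trans_line, line_self, Path.Homotopic.Quotient.refl_trans]

/-! ### The stars are contractible -/

section Contraction

variable {ε : ℝ}

lemma Holonomy.near_map (H : T.Holonomy (carrier a) s t g) (hε : 0 < ε) :
    T.Near s a ε ⟨t, map g a⟩ g :=
  ⟨H, fun j => by simpa only [map_perm_apply, sub_self, abs_zero] using hε⟩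

lemma Near.mix {c : stdSimplex ℝ (Fin (n + 1))} (H : T.Near s a ε ⟨t, b⟩ g)
    (H' : T.Near s a ε ⟨t, c⟩ g) (r : unitInterval) : T.Near s a ε ⟨t, mix b c r⟩ g := by
  refine ⟨H.holonomy, fun j => ?_⟩
  dsimp only
  rw [mix_apply, ← Real.dist_eq]
  exact convex_ball (a j) ε (H.abs_lt j) (H'.abs_lt j) (sub_nonneg.mpr r.2.2) r.2.1
    (sub_add_cancel _ _)

variable (T) in
/-- Moves the points of all simplices to `c` on straight segments, at unit time. -/
def moveTo (c : stdSimplex ℝ (Fin (n + 1))) : C(T.Simplices, C(unitInterval, T.Space)) where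
  toFun x := ⟨fun r => T.proj ⟨x.1, mix x.2 c r⟩, T.continuous_proj.comp <|
    continuous_sigmaMk.comp <| continuous_mix.comp
      (by fun_prop : Continuous fun r : unitInterval => ((x.2, c), r))⟩
  continuous_toFun := continuous_sigma fun _ =>
    ContinuousMap.continuous_of_continuous_uncurry _ <| T.continuous_proj.comp <|
      continuous_sigmaMk.comp <| continuous_mix.comp
        (by fun_prop : Continuous fun p : stdSimplex ℝ (Fin (n + 1)) × unitInterval =>
          ((p.1, c), p.2))

lemma moveTo_apply (c : stdSimplex ℝ (Fin (n + 1))) (x : T.Simplices) (r : unitInterval) :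
    T.moveTo c x r = T.proj ⟨x.1, mix x.2 c r⟩ := rfl

lemma Near.moveTo_eq_moveTo (hε : Separates a ε) {x x' : T.Simplices}
    {g' : Equiv.Perm (Fin (n + 1))} (H : T.Near s a ε x g) (H' : T.Near s a ε x' g')
    (h : T.proj x = T.proj x') : T.moveTo (map g a) x = T.moveTo (map g' a) x' := by
  obtain ⟨t, b⟩ := x
  obtain ⟨t', b'⟩ := x'
  obtain ⟨k, hk, rfl⟩ := proj_eq_iff.mp h
  have hmap : map g' a = map k (map g a) := by
    rw [← map_perm_mul]
    exact H'.map_eq_map hε (Near.move (x := ⟨t, b⟩) hε H hk)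
  have hc : carrier (map g a) ⊆ carrier b := by
    rw [carrier_map_perm]
    exact H.carrier_subset hε
  rw [hmap]
  refine ContinuousMap.ext fun r => ?_
  rw [moveTo_apply, moveTo_apply, ← map_perm_mix]
  exact (hk.proj_map ((carrier_mix_subset r).trans (Finset.union_subset subset_rfl hc))).symm

lemma exists_eq_moveTo (hε : Separates a ε) :
    ∃ f : T.star s a ε → C(unitInterval, T.Space), ∀ x g (H : T.Near s a ε x g),
      f ⟨T.proj x, x, ⟨g, H⟩, rfl⟩ = T.moveTo (map g a) x := by
  have hex : ∀ x : T.star s a ε, ∃ f : C(unitInterval, T.Space), ∀ y g, T.proj y = x →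
      T.Near s a ε y g → f = T.moveTo (map g a) y := by
    rintro ⟨_, x, ⟨g, hg⟩, rfl⟩
    exact ⟨_, fun x' g' h h' => hg.moveTo_eq_moveTo hε h' h.symm⟩
  choose f hf using hex
  exact ⟨f, fun x g H => hf _ x g rfl H⟩

lemma continuous_of_eq_moveTo (hε : Separates a ε) {f : T.star s a ε → C(unitInterval, T.Space)}
    (hf : ∀ x g (H : T.Near s a ε x g), f ⟨T.proj x, x, ⟨g, H⟩, rfl⟩ = T.moveTo (map g a) x) :
    Continuous f := by
  have hq : IsQuotientMap ((T.star s a ε).restrictPreimage T.proj) :=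
    (isQuotientMap_quot_mk (r := T.Rel)).restrictPreimage_isOpen (isOpen_star hε)
  rw [hq.continuous_iff, continuous_iff_continuousAt]
  rintro ⟨x, hx⟩
  obtain ⟨g, hg⟩ := (proj_mem_star_iff hε).mp hx
  have hnear : ∀ᶠ y : T.proj ⁻¹' T.star s a ε in 𝓝 ⟨x, hx⟩, T.Near s a ε y.1 g :=
    ((isOpen_near s a ε g).preimage continuous_subtype_val).mem_nhds hg
  refine ContinuousAt.congr (f := fun y => T.moveTo (map g a) y.1) ?_ ?_
  · exact ((T.moveTo (map g a)).continuous.comp continuous_subtype_val).continuousAt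
  · filter_upwards [hnear] with y hy
    exact (hf y.1 g hy).symm

lemma contractibleSpace_star (hε : Separates a ε) : ContractibleSpace (T.star s a ε) := by
  obtain ⟨f, hf⟩ := exists_eq_moveTo (T := T) (s := s) hε
  have hmem : ∀ x r, f x r ∈ T.star s a ε := by
    rintro ⟨_, ⟨t, b⟩, ⟨g, H⟩, rfl⟩ r
    rw [hf _ g H]
    exact ⟨_, ⟨g, H.mix (H.holonomy.near_map hε.pos) r⟩, rfl⟩
  rw [contractible_iff_id_nullhomotopic]
  refine ⟨⟨_, proj_mem_star_self hε.pos⟩, ⟨⟨⟨fun p => ⟨f p.2 p.1, hmem _ _⟩, ?_⟩, ?_, ?_⟩⟩⟩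
  · exact (((continuous_of_eq_moveTo hε hf).comp continuous_snd).eval continuous_fst).subtype_mk _
  · rintro ⟨_, x, ⟨g, H⟩, rfl⟩
    refine Subtype.ext ?_
    change f _ 0 = T.proj x
    rw [hf _ g H, moveTo_apply, mix_zero]
  · rintro ⟨_, x, ⟨g, H⟩, rfl⟩
    refine Subtype.ext ?_
    change f _ 1 = T.proj ⟨s, a⟩
    rw [hf _ g H, moveTo_apply, mix_one]
    exact H.holonomy.proj_map subset_rfl

end Contraction

/-! ### The dual graph carries the fundamental group -/

lemma mk_eq_mk_of_mem {X : Type*} [TopologicalSpace X] {U S : Set X} [SimplyConnectedSpace U]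
    (hU : U ⊆ S) {x y : S} {γ δ : Path x y} (hγ : ∀ r, (γ r).1 ∈ U) (hδ : ∀ r, (δ r).1 ∈ U) :
    Path.Homotopic.Quotient.mk γ = .mk δ := by
  have hx : x.1 ∈ U := γ.source ▸ hγ 0
  have hy : y.1 ∈ U := γ.target ▸ hγ 1
  let restrict (ε : Path x y) (hε : ∀ r, (ε r).1 ∈ U) : Path (⟨x, hx⟩ : U) ⟨y, hy⟩ :=
    { toFun r := ⟨ε r, hε r⟩
      continuous_toFun := (continuous_subtype_val.comp ε.continuous).subtype_mk _
      source' := Subtype.ext (congrArg (fun z : S => z.1) ε.source)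
      target' := Subtype.ext (congrArg (fun z : S => z.1) ε.target) }
  exact congrArg
    (fun c => Path.Homotopic.Quotient.map c ⟨Set.inclusion hU, continuous_inclusion hU⟩)
    (Subsingleton.elim (Path.Homotopic.Quotient.mk (restrict γ hγ)) (.mk (restrict δ hδ)))

section Star

variable {ε : ℝ} {s₀ : ι} {g' : Equiv.Perm (Fin (n + 1))}

lemma star_subset_compl_skeleton_zero (hε : Separates p.1 ε) :
    T.star s p.1 ε ⊆ (T.skeleton 0)ᶜ := by
  rintro _ ⟨⟨t, b⟩, ⟨g, hg⟩, rfl⟩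
  exact proj_mem_compl_skeleton_zero_iff.mpr (hg.lt_one hε p.2)

lemma mk_eq_line_trans_line (hε : Separates p.1 ε) {γ : Path x y}
    (hγ : ∀ r, (γ r).1 ∈ T.star s₀ p.1 ε) (H : T.Near s₀ p.1 ε ⟨s, q.1⟩ g)
    (H' : T.Near s₀ p.1 ε ⟨t, r.1⟩ g') (hx : T.pt s q = x) (hy : T.pt t r = y) :
    .mk γ = (T.line s q (p.map g) hx (H.holonomy.pt_map subset_rfl)).trans
      (T.line t (p.map g') r (H'.holonomy.pt_map subset_rfl) hy) := by
  have := contractibleSpace_star (T := T) (s := s₀) hε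
  refine mk_eq_mk_of_mem (star_subset_compl_skeleton_zero hε) hγ fun w => ?_
  suffices h : ∀ z ∈ Set.range (Path.trans _ _), (z : T.Punctured).1 ∈ T.star s₀ p.1 ε from
    h _ ⟨w, rfl⟩
  rw [Path.trans_range]
  rintro _ (⟨w, rfl⟩ | ⟨w, rfl⟩)
  · exact ⟨_, ⟨g, H.mix (H.holonomy.near_map hε.pos) w⟩, rfl⟩
  · exact ⟨_, ⟨g', (H'.holonomy.near_map hε.pos).mix H' w⟩, rfl⟩

/-- A class of paths which becomes the class of a dual path, when its end points are joined to the
barycentres of simplices containing them. -/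
def IsDual (hn : 3 ≤ n) (γ : Path.Homotopic.Quotient x y) : Prop :=
  ∀ (s t : ι) (p q : Core n) (hx : T.pt s p = x) (hy : T.pt t q = y),
    ∃ φ : T.FacetPath s t, .mk (φ.dualPath hn) =
      ((T.line s (Core.center hn) p (pt_center hn s) hx).trans γ).trans
        (T.line t q (Core.center hn) hy (pt_center hn t))

lemma isDual_of_mem_star (hn : 3 ≤ n) (hε : Separates p.1 ε) {γ : Path x y}
    (hγ : ∀ r, (γ r).1 ∈ T.star s₀ p.1 ε) : IsDual hn (.mk γ) := by
  intro s t q r hx hy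
  obtain ⟨g, H⟩ := (proj_mem_star_iff hε (x := ⟨s, q.1⟩)).mp <| by
    have := hγ 0
    rwa [γ.source, ← hx] at this
  obtain ⟨g', H'⟩ := (proj_mem_star_iff hε (x := ⟨t, r.1⟩)).mp <| by
    have := hγ 1
    rwa [γ.target, ← hy] at this
  have hp : (p.map g).map (g' * g⁻¹) = p.map g' := by
    rw [← Core.map_mul, inv_mul_cancel_right]
  have K : T.Holonomy (carrier (p.map g).1) s t (g' * g⁻¹) := by
    change T.Holonomy (carrier (map g p.1)) s t (g' * g⁻¹)
    rw [carrier_map_perm]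
    exact H.holonomy.symm.trans ((inv_smul_smul g (carrier p.1)).symm ▸ H'.holonomy)
  obtain ⟨φ, hφ⟩ := K.exists_mk_dualPath hn (H.holonomy.pt_map subset_rfl)
    (hp ▸ H'.holonomy.pt_map subset_rfl)
  simp only [hp] at hφ
  refine ⟨φ, ?_⟩
  rw [hφ, mk_eq_line_trans_line hε hγ H H' hx hy, ← Path.Homotopic.Quotient.trans_assoc,
    line_trans_line, Path.Homotopic.Quotient.trans_assoc, line_trans_line]

end Star

lemma IsDual.of_cast {hn : 3 ≤ n} {x' y' : T.Punctured} {γ : Path x y} {hx : x' = x} {hy : y' = y}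
    (h : IsDual hn (.mk (γ.cast hx hy))) : IsDual hn (.mk γ) := by
  subst hx hy
  exact h

lemma IsDual.trans {hn : 3 ≤ n} {γ : Path.Homotopic.Quotient x y}
    {δ : Path.Homotopic.Quotient y z} (hγ : IsDual hn γ) (hδ : IsDual hn δ) :
    IsDual hn (γ.trans δ) := by
  intro s t p q hx hz
  obtain ⟨u, r, hy⟩ := exists_pt_eq y
  obtain ⟨φ, hφ⟩ := hγ s u p r hx hy
  obtain ⟨ψ, hψ⟩ := hδ u t r q hy hz
  refine ⟨φ.append ψ, ?_⟩
  rw [FacetPath.mk_dualPath_append, hφ, hψ]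
  simp only [Path.Homotopic.Quotient.trans_assoc]
  rw [← Path.Homotopic.Quotient.trans_assoc (T.line u r (Core.center hn) _ _), line_trans_line,
    line_self, Path.Homotopic.Quotient.refl_trans]

lemma exists_subdivision_mem_star (γ : Path x y) :
    ∃ τ : ℕ → unitInterval, Monotone τ ∧ τ 0 = 0 ∧ (∃ m, τ m = 1) ∧
      ∀ k, ∃ (s : ι) (p : Core n) (ε : ℝ), Separates p.1 ε ∧
        ∀ r ∈ Set.Icc (τ k) (τ (k + 1)), (γ r).1 ∈ T.star s p.1 ε := by
  choose s p hsp using fun r => exists_pt_eq (γ r)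
  choose ε hε using fun r => exists_separates (p r).1
  have hopen : ∀ r, IsOpen {u | (γ u).1 ∈ T.star (s r) (p r).1 (ε r)} := fun r =>
    (isOpen_star (hε r)).preimage (continuous_subtype_val.comp γ.continuous)
  obtain ⟨τ, h0, hmono, ⟨m, hm⟩, hτ⟩ := exists_monotone_Icc_subset_open_cover_unitInterval hopen
    fun r _ => Set.mem_iUnion.mpr ⟨r, by
      rw [Set.mem_ofPred_eq, ← hsp r]
      exact proj_mem_star_self (hε r).pos⟩
  refine ⟨τ, hmono, h0, ⟨m, hm m le_rfl⟩, fun k => ?_⟩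
  obtain ⟨r, hr⟩ := hτ k
  exact ⟨s r, p r, ε r, hε r, hr⟩

lemma isDual (hn : 3 ≤ n) (γ : Path x y) : IsDual hn (.mk γ) := by
  obtain ⟨τ, hmono, h0, ⟨m, hm⟩, hτ⟩ := exists_subdivision_mem_star γ
  have piece (k : ℕ) : IsDual hn (.mk (γ.subpath (τ k) (τ (k + 1)))) := by
    obtain ⟨s, p, ε, hε, hstar⟩ := hτ k
    refine isDual_of_mem_star (s₀ := s) hn hε fun w => ?_
    obtain ⟨w', hw', h⟩ : γ.subpath (τ k) (τ (k + 1)) w ∈ γ '' Set.Icc (τ k) (τ (k + 1)) := by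
      rw [← Path.range_subpath_of_le _ _ _ (hmono k.le_succ)]
      exact ⟨w, rfl⟩
    exact h ▸ hstar w' hw'
  have initial (k : ℕ) : IsDual hn (.mk (γ.subpath (τ 0) (τ (k + 1)))) := by
    induction k with
    | zero => exact piece 0
    | succ k ih =>
      have h := ih.trans (piece (k + 1))
      rwa [← Path.Homotopic.Quotient.mk_trans, Path.Homotopic.Quotient.eq.mpr
        ⟨Path.Homotopy.subpathTransSubpath γ (τ 0) (τ (k + 1)) (τ (k + 2))⟩] at h
  obtain ⟨k, rfl⟩ : ∃ k, m = k + 1 :=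
    Nat.exists_eq_succ_of_ne_zero fun h => zero_ne_one (α := unitInterval) (by rw [← h0, ← hm, h])
  have h := initial k
  rw [h0, hm, Path.subpath_zero_one] at h
  exact h.of_cast

lemma exists_loopClass_eq (hn : 3 ≤ n) (c : FundamentalGroup T.Punctured (T.center hn s)) :
    ∃ φ : T.FacetPath s s, φ.loopClass hn = c := by
  obtain ⟨γ, rfl⟩ := Path.Homotopic.Quotient.mk_surjective c
  obtain ⟨φ, hφ⟩ := isDual hn γ s s (Core.center hn) (Core.center hn) (pt_center hn s)
    (pt_center hn s)
  refine ⟨φ, hφ.trans ?_⟩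
  rw [line_self, Path.Homotopic.Quotient.refl_trans, Path.Homotopic.Quotient.trans_refl]

/-! ### Uniqueness and non-triviality -/

lemma finite_skeleton_zero [Finite ι] (T : SingularTriangulation n ι) : (T.skeleton 0).Finite := by
  refine (Set.finite_range fun v : ι × Fin (n + 1) => T.proj ⟨v.1, vertex v.2⟩).subset ?_
  intro x hx
  obtain ⟨s, a, rfl⟩ := exists_proj_eq x
  obtain ⟨j, hj⟩ := proj_mem_skeleton_zero_iff.mp hx
  exact ⟨(s, j), by rw [eq_vertex_of_apply_eq_one hj]⟩

lemma exists_proj_vertex_eq (hcard : (T.skeleton 0).encard < n + 1) (s : ι) :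
    ∃ v v' : Fin (n + 1), v ≠ v' ∧ T.proj ⟨s, vertex v⟩ = T.proj ⟨s, vertex v'⟩ := by
  have hvertex : Set.MapsTo (fun v => T.proj ⟨s, vertex v⟩) Set.univ (T.skeleton 0) := fun v _ =>
    proj_mem_skeleton_zero_iff.mpr ⟨v, Pi.single_eq_same v 1⟩
  obtain ⟨v, -, v', -, hne, h⟩ := Set.exists_ne_map_eq_of_encard_lt_of_maps_to
    (by simpa using hcard) hvertex
  exact ⟨v, v', hne, h⟩

namespace IsCanonicalRepresentation

variable {hn : 3 ≤ n}
  {ρ ρ' : FundamentalGroup T.Punctured (T.center hn s) →* Equiv.Perm (Fin (n + 1))}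

lemma unique (hρ : T.IsCanonicalRepresentation hn s ρ) (hρ' : T.IsCanonicalRepresentation hn s ρ') :
    ρ = ρ' := by
  ext1 c
  obtain ⟨γ, rfl⟩ := exists_loopClass_eq hn c
  rw [hρ γ, hρ' γ]

lemma ne_one (hρ : T.IsCanonicalRepresentation hn s ρ) (hcard : (T.skeleton 0).encard < n + 1) :
    ρ ≠ 1 := by
  rintro rfl
  obtain ⟨v, v', hne, h⟩ := exists_proj_vertex_eq hcard s
  obtain ⟨γ, -, hγ⟩ := exists_isReduced_projectivity_eq h
  exact hne (by rw [← hγ, ← hρ γ]; rfl)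

end IsCanonicalRepresentation

end SingularTriangulation

end

/-- A singlex of infinite degree counts as one of even degree, because `Set.ncard` is then `0`. -/
theorem mainTheorem6_general {n : ℕ} (hn : 3 ≤ n) {ι : Type*} (T : SingularTriangulation n ι) :
    (∀ (s : ι) (v v' : Fin (n + 1)),
      T.proj ⟨s, stdSimplex.vertex v⟩ = T.proj ⟨s, stdSimplex.vertex v'⟩ →
        ∃ γ : T.FacetPath s s, γ.IsReduced ∧ γ.projectivity v = v') ∧
    (T.IsEven →
      (4 ≤ n → T.InjectiveOnInteriors ∧ T.LinksSimplyConnected) →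
      (T.skeleton 0).encard < n + 1 →
      ∀ s : ι,
        (∃! ρ : FundamentalGroup T.Punctured (T.center hn s) →* Equiv.Perm (Fin (n + 1)),
          T.IsCanonicalRepresentation hn s ρ) ∧
        (∀ ρ : FundamentalGroup T.Punctured (T.center hn s) →* Equiv.Perm (Fin (n + 1)),
          T.IsCanonicalRepresentation hn s ρ → ρ.range ≠ ⊥) ∧
        Nontrivial (FundamentalGroup T.Punctured (T.center hn s))) := by
  refine ⟨fun _ _ _ h => SingularTriangulation.exists_isReduced_projectivity_eq h,
    fun heven hlinks hcard s => ?_⟩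
  obtain ⟨ρ, hρ⟩ := SingularTriangulation.exists_isCanonicalRepresentation hn
    (fun s a ha => SingularTriangulation.locallyTrivial_of_two_le_card_carrier (s := s) (by omega)
      heven hlinks (SingularTriangulation.two_le_card_carrier ha)) s
  refine ⟨⟨ρ, hρ, fun ρ' hρ' => hρ'.unique hρ⟩,
    fun ρ' hρ' h => hρ'.ne_one hcard (MonoidHom.range_eq_bot_iff.mp h), ?_⟩
  by_contra h
  have := not_nontrivial_iff_subsingleton.mp h
  exact hρ.ne_one hcard (Subsingleton.elim ρ 1)

theorem mainTheorem6 {n : ℕ} (hn : 3 ≤ n) {ι : Type*} [Finite ι]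
    (T : SingularTriangulation n ι) [ConnectedSpace T.Space] :
    (∀ (s : ι) (v v' : Fin (n + 1)),
      T.proj ⟨s, stdSimplex.vertex v⟩ = T.proj ⟨s, stdSimplex.vertex v'⟩ →
        ∃ γ : T.FacetPath s s, γ.IsReduced ∧ γ.projectivity v = v') ∧
    (T.IsEven →
      (4 ≤ n → T.InjectiveOnInteriors ∧ T.LinksSimplyConnected) →
      (T.skeleton 0).ncard < n + 1 →
      ∀ s : ι,
        (∃! ρ : FundamentalGroup T.Punctured (T.center hn s) →* Equiv.Perm (Fin (n + 1)),
          T.IsCanonicalRepresentation hn s ρ) ∧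
        (∀ ρ : FundamentalGroup T.Punctured (T.center hn s) →* Equiv.Perm (Fin (n + 1)),
          T.IsCanonicalRepresentation hn s ρ → ρ.range ≠ ⊥) ∧
        Nontrivial (FundamentalGroup T.Punctured (T.center hn s))) := by
  obtain ⟨hvertex, hrep⟩ := mainTheorem6_general hn T
  refine ⟨hvertex, fun heven hlinks hcard => hrep heven hlinks ?_⟩
  rw [← T.finite_skeleton_zero.cast_ncard_eq]
  exact_mod_cast hcard
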